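/- Let $d\ge 1$, let $\Omega\subset\mathbb R^d$ be a bounded open set (for instance a bounded Lipschitz domain), let $S_0,S_1\subset\Omega$ be disjoint measurable sets and let $$\mathcal U=\{\varphi\in L^1(\Omega):\ \varphi=-1\text{ a.e. on }S_0,\ \varphi=1\text{ a.e. on }S_1\}.$$ Let $\varphi\in BV(\Omega,\{\pm1\})\cap\mathcal U$ be such that $E^\varphi=\{x\in\Omega:\varphi(x)=1\}$ contains, up to a null set, an open ball $B\subset\Omega$. Put $$V^\varphi=\{\eta\in H^1_0(\Omega):\ \eta=0\text{ a.e. in }\Omega\setminus E^\varphi\},\qquad (v,w)_{V^\varphi}=\int_\Omega\nabla v\cdot\nabla w\,dx,$$ and let $(\cdot,\cdot)$ be the scalar product of $L^2(\Omega)$. Consider the problem of finding $(w,\lambda)\in(V^\varphi\setminus\{0\})\times\mathbb R$ such that $$\int_\Omega\nabla w\cdot\nabla\eta\,dx=\lambda\int_\Omega w\,\eta\,dx\qquad\text{for all }\eta\in V^\varphi. \tag{$*$}$$ (a) There is a sequence $(w_k,\lambda_k)_{k\ge1}$ in $(V^\varphi\setminus\{0\})\times\mathbb R$ such that: - each $w_k$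 is an eigenfunction of $(*)$ for the eigenvalue $\lambda_k$, and $(w_j,w_k)=\delta_{jk}$ for all $j,k$; - $0<\lambda_1\le\lambda_2\le\lambda_3\le\cdots$, $\lambda_k\to\infty$, there are no further eigenvalues of $(*)$, and each eigenvalue has a finite-dimensional eigenspace and occurs in the sequence exactly as often as the dimension of that eigenspace; - the functions $w_k/\sqrt{\lambda_k}$, $k\ge1$, form an orthonormal basis of $(V^\varphi,(\cdot,\cdot)_{V^\varphi})$, and every $u\in V^\varphi$ satisfies $u=\sum_{i=1}^\infty(u,w_i)\,w_i$ with convergence in $V^\varphi$ (in the $H^1$ norm). (b) For the same sequence and every $k\ge1$, let $\mathcal S_{k-1}$ be the collection of all $(k-1)$-dimensional subspaces of $L^2(\Omega)$, and let $U^\perp$ denote the orthogonal complement of $U$ in $L^2(\Omega)$. Then $$\lambda_k=\max_{U\in\mathcal S_{k-1}}\ \min\left\{\frac{\int_\Omega|\nabla v|^2\,dx}{\int_\Omega|v|^2\,dx}\ :\ v\in U^\perp\cap V^\varphi,\ v\ne0\right\},$$ where all the minima and the maximum exist, and the maximum is attained at $U=\operatorname{span}\{w_1,\dots,w_{k-1}\}$.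 -/

import Mathlib

open MeasureTheory TopologicalSpace Filter Topology
open scoped Distributions

noncomputable section

namespace LimitEigenvalue

/-- The Euclidean space `ℝ^d`. -/
abbrev Rd (d : ℕ) : Type := EuclideanSpace ℝ (Fin d)

/-- The Lebesgue space `L²(Ω)` with its canonical inner product. -/
abbrev L2 {d : ℕ} (Ω : Opens (Rd d)) : Type :=
  Lp ℝ 2 (volume.restrict (Ω : Set (Rd d)))

/-- The Lebesgue space `L²(Ω; ℝ^d)` of square integrable vector fields, with its canonical
inner product `(F, G) ↦ ∫_Ω F · G`. -/
abbrev L2Vec {d : ℕ} (Ω : Opens (Rd d)) : Type :=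
  Lp (Rd d) 2 (volume.restrict (Ω : Set (Rd d)))

/-- The Hilbert space `L²(Ω) × L²(Ω; ℝ^d)`, with `‖(u, G)‖² = ‖u‖² + ‖G‖²`. A Sobolev function
`u` is represented in it by the pair `(u, ∇u)`, so that the norm becomes the `H¹(Ω)` norm. -/
abbrev L2Pair {d : ℕ} (Ω : Opens (Rd d)) : Type :=
  WithLp 2 (L2 Ω × L2Vec Ω)

variable {d : ℕ}

/-- The partial derivative `∂_i f (x)`. -/
def partialDeriv (i : Fin d) (f : Rd d → ℝ) (x : Rd d) : ℝ :=
  fderiv ℝ f x (EuclideanSpace.single i 1)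

/-- The divergence `∑_i ∂_i X_i` of a vector field. -/
def divergence (X : Rd d → Rd d) (x : Rd d) : ℝ :=
  ∑ i : Fin d, partialDeriv i (fun y => X y i) x

theorem memLp_testFunction (Ω : Opens (Rd d)) (ψ : 𝓓(Ω, ℝ)) :
    MemLp (ψ : Rd d → ℝ) 2 (volume.restrict (Ω : Set (Rd d))) :=
  (ψ.continuous.memLp_of_hasCompactSupport ψ.hasCompactSupport).restrict _

theorem memLp_partialDeriv (Ω : Opens (Rd d)) (ψ : 𝓓(Ω, ℝ)) (i : Fin d) :
    MemLp (partialDeriv i ψ) 2 (volume.restrict (Ω : Set (Rd d))) := by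
  have h1 : Continuous (partialDeriv i (ψ : Rd d → ℝ)) :=
    (ψ.contDiff.continuous_fderiv (by simp)).clm_apply continuous_const
  have h2 : HasCompactSupport (partialDeriv i (ψ : Rd d → ℝ)) :=
    ψ.hasCompactSupport.fderiv_apply (𝕜 := ℝ) _
  exact (h1.memLp_of_hasCompactSupport h2).restrict _

theorem memLp_coord (Ω : Opens (Rd d)) (G : L2Vec Ω) (i : Fin d) :
    MemLp (fun x => G x i) 2 (volume.restrict (Ω : Set (Rd d))) :=
  (EuclideanSpace.proj (𝕜 := ℝ) i).comp_memLp' (Lp.memLp G)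

theorem zero_fst_ae (Ω : Opens (Rd d)) :
    ∀ᵐ x ∂volume.restrict (Ω : Set (Rd d)), (0 : L2Pair Ω).fst x = 0 :=
  Lp.coeFn_zero ℝ 2 _

theorem zero_snd_ae (Ω : Opens (Rd d)) :
    ∀ᵐ x ∂volume.restrict (Ω : Set (Rd d)), (0 : L2Pair Ω).snd x = 0 :=
  Lp.coeFn_zero (Rd d) 2 _

theorem add_fst_ae {Ω : Opens (Rd d)} (p q : L2Pair Ω) :
    ∀ᵐ x ∂volume.restrict (Ω : Set (Rd d)), (p + q).fst x = p.fst x + q.fst x :=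
  Lp.coeFn_add p.fst q.fst

theorem add_snd_ae {Ω : Opens (Rd d)} (p q : L2Pair Ω) :
    ∀ᵐ x ∂volume.restrict (Ω : Set (Rd d)), (p + q).snd x = p.snd x + q.snd x :=
  Lp.coeFn_add p.snd q.snd

theorem smul_fst_ae {Ω : Opens (Rd d)} (c : ℝ) (p : L2Pair Ω) :
    ∀ᵐ x ∂volume.restrict (Ω : Set (Rd d)), (c • p).fst x = c * p.fst x :=
  Lp.coeFn_smul c p.fst

theorem smul_snd_ae {Ω : Opens (Rd d)} (c : ℝ) (p : L2Pair Ω) :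
    ∀ᵐ x ∂volume.restrict (Ω : Set (Rd d)), (c • p).snd x = c • p.snd x :=
  Lp.coeFn_smul c p.snd

theorem integral_fst_mul {Ω : Opens (Rd d)} (p q : L2Pair Ω) :
    ∫ x in (Ω : Set (Rd d)), p.fst x * q.fst x = inner ℝ p.fst q.fst := by
  rw [L2.inner_def]
  refine integral_congr_ae (Eventually.of_forall fun x => ?_)
  exact mul_comm _ _

theorem integral_inner_snd {Ω : Opens (Rd d)} (p q : L2Pair Ω) :
    ∫ x in (Ω : Set (Rd d)), inner ℝ (p.snd x) (q.snd x) = inner ℝ p.snd q.snd :=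
  (L2.inner_def _ _).symm

/-- `G` is the weak gradient of `u` on `Ω`: `∫_Ω u ∂_i ψ = - ∫_Ω G_i ψ` for all test functions
`ψ ∈ C_c^∞(Ω)` and all `i`. -/
def IsWeakGradient (Ω : Opens (Rd d)) (u : L2 Ω) (G : L2Vec Ω) : Prop :=
  ∀ (ψ : 𝓓(Ω, ℝ)) (i : Fin d),
    ∫ x in (Ω : Set (Rd d)), u x * partialDeriv i ψ x
      = -∫ x in (Ω : Set (Rd d)), G x i * ψ x

/-- The Sobolev space `H¹(Ω)`: all pairs `(u, ∇u)` with `u ∈ L²(Ω)` whose weak gradient `∇u`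
belongs to `L²(Ω; ℝ^d)`. -/
def H1 (Ω : Opens (Rd d)) : Submodule ℝ (L2Pair Ω) where
  carrier := {p | IsWeakGradient Ω p.fst p.snd}
  zero_mem' := by
    intro ψ i
    have h1 := zero_fst_ae Ω
    have h2 := zero_snd_ae Ω
    rw [integral_eq_zero_of_ae, integral_eq_zero_of_ae, neg_zero]
    · filter_upwards [h2] with x hx
      rw [hx]; simp
    · filter_upwards [h1] with x hx
      rw [hx]; simp
  add_mem' := by
    intro p q hp hq ψ i
    have hu := add_fst_ae p q
    have hG := add_snd_ae p q
    have e1 : ∫ x in (Ω : Set (Rd d)), (p + q).fst x * partialDeriv i ψ x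
        = ∫ x in (Ω : Set (Rd d)),
            (p.fst x * partialDeriv i ψ x + q.fst x * partialDeriv i ψ x) := by
      refine integral_congr_ae ?_
      filter_upwards [hu] with x hx
      rw [hx]; simp [add_mul]
    have e2 : ∫ x in (Ω : Set (Rd d)), (p + q).snd x i * ψ x
        = ∫ x in (Ω : Set (Rd d)), (p.snd x i * ψ x + q.snd x i * ψ x) := by
      refine integral_congr_ae ?_
      filter_upwards [hG] with x hx
      rw [hx]; simp [add_mul]
    rw [e1, e2,
      integral_add (by exact (Lp.memLp p.fst).integrable_mul (memLp_partialDeriv Ω ψ i))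
        (by exact (Lp.memLp q.fst).integrable_mul (memLp_partialDeriv Ω ψ i)),
      integral_add (by exact (memLp_coord Ω p.snd i).integrable_mul (memLp_testFunction Ω ψ))
        (by exact (memLp_coord Ω q.snd i).integrable_mul (memLp_testFunction Ω ψ)),
      hp ψ i, hq ψ i]
    ring
  smul_mem' := by
    intro c p hp ψ i
    have hu := smul_fst_ae c p
    have hG := smul_snd_ae c p
    have e1 : ∫ x in (Ω : Set (Rd d)), (c • p).fst x * partialDeriv i ψ x
        = ∫ x in (Ω : Set (Rd d)), c * (p.fst x * partialDeriv i ψ x) := by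
      refine integral_congr_ae ?_
      filter_upwards [hu] with x hx
      rw [hx]; simp [mul_assoc]
    have e2 : ∫ x in (Ω : Set (Rd d)), (c • p).snd x i * ψ x
        = ∫ x in (Ω : Set (Rd d)), c * (p.snd x i * ψ x) := by
      refine integral_congr_ae ?_
      filter_upwards [hG] with x hx
      rw [hx]; simp [mul_assoc]
    rw [e1, e2, integral_const_mul, integral_const_mul, hp ψ i]
    ring

/-- The pairs `(ψ, ∇ψ)` with classical gradient `∇ψ`, for `ψ ∈ C_c^∞(Ω)`. -/
def testPairs (Ω : Opens (Rd d)) : Submodule ℝ (L2Pair Ω) where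
  carrier := {p | ∃ ψ : 𝓓(Ω, ℝ),
    (∀ᵐ x ∂volume.restrict (Ω : Set (Rd d)), p.fst x = ψ x) ∧
    (∀ᵐ x ∂volume.restrict (Ω : Set (Rd d)), p.snd x = gradient (ψ : Rd d → ℝ) x)}
  zero_mem' := by
    refine ⟨0, ?_, ?_⟩
    · filter_upwards [zero_fst_ae Ω] with x hx
      rw [hx]; simp
    · filter_upwards [zero_snd_ae Ω] with x hx
      rw [hx]; simp [gradient]
  add_mem' := by
    rintro p q ⟨ψ, h1, h2⟩ ⟨χ, h3, h4⟩
    refine ⟨ψ + χ, ?_, ?_⟩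
    · filter_upwards [h1, h3, add_fst_ae p q] with x a b c
      rw [c, a, b]; simp
    · filter_upwards [h2, h4, add_snd_ae p q] with x a b c
      have hψ : DifferentiableAt ℝ (ψ : Rd d → ℝ) x :=
        (ψ.contDiff.differentiable (by simp)).differentiableAt
      have hχ : DifferentiableAt ℝ (χ : Rd d → ℝ) x :=
        (χ.contDiff.differentiable (by simp)).differentiableAt
      rw [c, a, b]; simp [gradient, fderiv_add hψ hχ]
  smul_mem' := by
    rintro c p ⟨ψ, h1, h2⟩
    refine ⟨c • ψ, ?_, ?_⟩
    · filter_upwards [h1, smul_fst_ae c p] with x a b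
      rw [b, a]; simp
    · filter_upwards [h2, smul_snd_ae c p] with x a b
      have hψ : DifferentiableAt ℝ (ψ : Rd d → ℝ) x :=
        (ψ.contDiff.differentiable (by simp)).differentiableAt
      rw [b, a]; simp [gradient, fderiv_const_smul hψ]

/-- The Sobolev space `H¹₀(Ω)`: the closure of `C_c^∞(Ω)` in the `H¹(Ω)` norm. It is contained in
`H1 Ω`, see `H10_le_H1`. -/
def H10 (Ω : Opens (Rd d)) : Submodule ℝ (L2Pair Ω) :=
  (testPairs Ω).topologicalClosure

theorem testPairs_le_H1 (Ω : Opens (Rd d)) : testPairs Ω ≤ H1 Ω := by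
  rintro p ⟨χ, h1, h2⟩ ψ i
  have hψd : Differentiable ℝ (ψ : Rd d → ℝ) := ψ.contDiff.differentiable (by simp)
  have hχd : Differentiable ℝ (χ : Rd d → ℝ) := χ.contDiff.differentiable (by simp)
  have cψ : Continuous (partialDeriv i (ψ : Rd d → ℝ)) :=
    (ψ.contDiff.continuous_fderiv (by simp)).clm_apply continuous_const
  have cχ : Continuous (partialDeriv i (χ : Rd d → ℝ)) :=
    (χ.contDiff.continuous_fderiv (by simp)).clm_apply continuous_const
  have key : ∫ x, χ x * partialDeriv i ψ x = -∫ x, partialDeriv i χ x * ψ x := by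
    refine integral_mul_fderiv_eq_neg_fderiv_mul_of_integrable ?_ ?_ ?_
      (fun x _ => hχd x) (fun x _ => hψd x)
    · exact (cχ.mul ψ.continuous).integrable_of_hasCompactSupport
        ψ.hasCompactSupport.mul_left
    · exact (χ.continuous.mul cψ).integrable_of_hasCompactSupport
        χ.hasCompactSupport.mul_right
    · exact (χ.continuous.mul ψ.continuous).integrable_of_hasCompactSupport
        χ.hasCompactSupport.mul_right
  have e1 : ∫ x in (Ω : Set (Rd d)), p.fst x * partialDeriv i ψ x
      = ∫ x, χ x * partialDeriv i ψ x := by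
    rw [← setIntegral_eq_integral_of_forall_compl_eq_zero (s := (Ω : Set (Rd d)))
      (f := fun x => χ x * partialDeriv i ψ x)]
    · refine integral_congr_ae ?_
      filter_upwards [h1] with x hx
      rw [hx]
    · intro x hx
      rw [image_eq_zero_of_notMem_tsupport (fun h => hx (χ.tsupport_subset h)), zero_mul]
  have e2 : ∫ x in (Ω : Set (Rd d)), p.snd x i * ψ x = ∫ x, partialDeriv i χ x * ψ x := by
    rw [← setIntegral_eq_integral_of_forall_compl_eq_zero (s := (Ω : Set (Rd d)))
      (f := fun x => partialDeriv i χ x * ψ x)]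
    · refine integral_congr_ae ?_
      filter_upwards [h2] with x hx
      have : gradient (χ : Rd d → ℝ) x i = partialDeriv i χ x := by
        rw [partialDeriv, ← inner_gradient_left (𝕜 := ℝ), EuclideanSpace.inner_single_right]
        simp
      rw [hx, this]
    · intro x hx
      rw [image_eq_zero_of_notMem_tsupport (fun h => hx (ψ.tsupport_subset h)), mul_zero]
  rw [e1, e2, key]

theorem isClosed_H1 (Ω : Opens (Rd d)) : IsClosed (H1 Ω : Set (L2Pair Ω)) := by
  have h : (H1 Ω : Set (L2Pair Ω)) = ⋂ (ψ : 𝓓(Ω, ℝ)) (i : Fin d),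
      {p : L2Pair Ω | inner ℝ ((memLp_partialDeriv Ω ψ i).toLp _) p.fst
        = -inner ℝ ((memLp_testFunction Ω ψ).toLp _)
            ((EuclideanSpace.proj (𝕜 := ℝ) i).compLp p.snd)} := by
    ext p
    simp only [Set.mem_iInter]
    refine forall_congr' fun ψ => forall_congr' fun i => ?_
    have e1 : inner ℝ ((memLp_partialDeriv Ω ψ i).toLp _) p.fst
        = ∫ x in (Ω : Set (Rd d)), p.fst x * partialDeriv i ψ x := by
      rw [L2.inner_def]
      refine integral_congr_ae ?_
      filter_upwards [(memLp_partialDeriv Ω ψ i).coeFn_toLp] with x hx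
      simp [hx]
    have e2 : inner ℝ ((memLp_testFunction Ω ψ).toLp _)
          ((EuclideanSpace.proj (𝕜 := ℝ) i).compLp p.snd)
        = ∫ x in (Ω : Set (Rd d)), p.snd x i * ψ x := by
      rw [L2.inner_def]
      refine integral_congr_ae ?_
      filter_upwards [(memLp_testFunction Ω ψ).coeFn_toLp,
        (EuclideanSpace.proj (𝕜 := ℝ) i).coeFn_compLp p.snd] with x hx hy
      simp [hx, hy]
    rw [Set.mem_ofPred_eq, e1, e2]
  rw [h]
  refine isClosed_iInter fun ψ => isClosed_iInter fun i => isClosed_eq ?_ ?_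
  · exact continuous_const.inner (WithLp.continuous_fst _ _ _)
  · refine (continuous_const.inner ?_).neg
    exact ((EuclideanSpace.proj (𝕜 := ℝ) i).compLpL 2 _).continuous.comp
      (WithLp.continuous_snd _ _ _)

theorem H10_le_H1 (Ω : Opens (Rd d)) : H10 Ω ≤ H1 Ω :=
  Submodule.topologicalClosure_minimal _ (testPairs_le_H1 Ω) (isClosed_H1 Ω)

/-- `φ ∈ BV(Ω, {±1})`: `φ ∈ L¹(Ω)` takes the values `±1` a.e. on `Ω` and has finite total
variation `sup {∫_Ω φ div X : X ∈ C_c^1(Ω; ℝ^d), |X| ≤ 1}`. -/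
def IsBVSign (Ω : Opens (Rd d)) (φ : Rd d → ℝ) : Prop :=
  IntegrableOn φ (Ω : Set (Rd d)) ∧
  (∀ᵐ x ∂volume.restrict (Ω : Set (Rd d)), φ x = 1 ∨ φ x = -1) ∧
  BddAbove {t : ℝ | ∃ X : 𝓓^{1}(Ω, Rd d), (∀ x, ‖X x‖ ≤ 1) ∧
    t = ∫ x in (Ω : Set (Rd d)), φ x * divergence X x}

/-- The constraint set `𝓤` of all `φ ∈ L¹(Ω)` with `φ = -1` a.e. on `S₀` and `φ = 1` a.e.
on `S₁`. -/
def constraintSet (Ω : Opens (Rd d)) (S₀ S₁ : Set (Rd d)) : Set (Rd d → ℝ) :=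
  {φ | IntegrableOn φ (Ω : Set (Rd d)) ∧
    (∀ᵐ x ∂volume.restrict S₀, φ x = -1) ∧ (∀ᵐ x ∂volume.restrict S₁, φ x = 1)}

/-- The space `V^φ` of all `η ∈ H¹₀(Ω)` with `η = 0` a.e. in `Ω \ {φ = 1}`. -/
def V (Ω : Opens (Rd d)) (φ : Rd d → ℝ) : Submodule ℝ (L2Pair Ω) where
  carrier := {p | p ∈ H10 Ω ∧
    ∀ᵐ x ∂volume.restrict (Ω : Set (Rd d)), φ x ≠ 1 → p.fst x = 0}
  zero_mem' := by
    refine ⟨(H10 Ω).zero_mem, ?_⟩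
    filter_upwards [zero_fst_ae Ω] with x hx _
    exact hx
  add_mem' := by
    rintro p q ⟨hp, hp'⟩ ⟨hq, hq'⟩
    refine ⟨(H10 Ω).add_mem hp hq, ?_⟩
    filter_upwards [hp', hq', add_fst_ae p q] with x a b c hx
    rw [c, a hx, b hx, add_zero]
  smul_mem' := by
    rintro c p ⟨hp, hp'⟩
    refine ⟨(H10 Ω).smul_mem c hp, ?_⟩
    filter_upwards [hp', smul_fst_ae c p] with x a b hx
    rw [b, a hx, mul_zero]

/-- The solution space `{w ∈ V^φ : ∫_Ω ∇w · ∇η = μ ∫_Ω w η for all η ∈ V^φ}` of the limit problem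
with parameter `μ`. -/
def eigenspace (Ω : Opens (Rd d)) (φ : Rd d → ℝ) (μ : ℝ) : Submodule ℝ (L2Pair Ω) where
  carrier := {w | w ∈ V Ω φ ∧ ∀ η ∈ V Ω φ,
    ∫ x in (Ω : Set (Rd d)), inner ℝ (w.snd x) (η.snd x)
      = μ * ∫ x in (Ω : Set (Rd d)), w.fst x * η.fst x}
  zero_mem' := by
    refine ⟨(V Ω φ).zero_mem, fun η _ => ?_⟩
    have h1 := zero_fst_ae Ω
    have h2 := zero_snd_ae Ω
    rw [integral_eq_zero_of_ae, integral_eq_zero_of_ae, mul_zero]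
    · filter_upwards [h1] with x hx
      rw [hx]; simp
    · filter_upwards [h2] with x hx
      rw [hx]; simp
  add_mem' := by
    rintro p q ⟨hp, hp'⟩ ⟨hq, hq'⟩
    refine ⟨(V Ω φ).add_mem hp hq, fun η hη => ?_⟩
    have hp1 := hp' η hη
    have hq1 := hq' η hη
    rw [integral_inner_snd, integral_fst_mul] at hp1 hq1 ⊢
    rw [WithLp.add_snd, WithLp.add_fst, inner_add_left, inner_add_left, hp1, hq1, mul_add]
  smul_mem' := by
    rintro c p ⟨hp, hp'⟩
    refine ⟨(V Ω φ).smul_mem c hp, fun η hη => ?_⟩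
    have hp1 := hp' η hη
    rw [integral_inner_snd, integral_fst_mul] at hp1 ⊢
    rw [WithLp.smul_snd, WithLp.smul_fst, real_inner_smul_left, real_inner_smul_left, hp1]
    ring

/-- `(w, μ)` solves the limit eigenvalue problem, that is, `w ∈ V^φ \ {0}` and
`∫_Ω ∇w · ∇η = μ ∫_Ω w η` for all `η ∈ V^φ`. -/
def IsEigenpair (Ω : Opens (Rd d)) (φ : Rd d → ℝ) (w : L2Pair Ω) (μ : ℝ) : Prop :=
  w ∈ eigenspace Ω φ μ ∧ w ≠ 0

/-- `e` is an orthonormal basis of `V^φ` equipped with the scalar product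
`(v, w)_V = ∫_Ω ∇v · ∇w`: it is an orthonormal system in `V^φ` whose span is dense. -/
def IsOrthonormalBasisOfV (Ω : Opens (Rd d)) (φ : Rd d → ℝ) (e : ℕ → L2Pair Ω) : Prop :=
  (∀ k, e k ∈ V Ω φ) ∧
  (∀ j k, ∫ x in (Ω : Set (Rd d)), inner ℝ ((e j).snd x) ((e k).snd x)
    = if j = k then 1 else 0) ∧
  ∀ u ∈ V Ω φ, ∀ ε > 0, ∃ v ∈ Submodule.span ℝ (Set.range e),
    ∫ x in (Ω : Set (Rd d)), ‖(u - v).snd x‖ ^ 2 < ε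

/-- The collection `𝒮_k` of all `k`-dimensional subspaces of `L²(Ω)`. -/
def subspacesOfDim (Ω : Opens (Rd d)) (k : ℕ) : Set (Submodule ℝ (L2 Ω)) :=
  {U | FiniteDimensional ℝ U ∧ Module.finrank ℝ U = k}

/-- The values of the Rayleigh quotient `∫_Ω |∇v|² / ∫_Ω |v|²` over all `0 ≠ v ∈ V^φ` that are
orthogonal to `U` in `L²(Ω)`. -/
def rayleighValues (Ω : Opens (Rd d)) (φ : Rd d → ℝ) (U : Submodule ℝ (L2 Ω)) : Set ℝ :=
  {r | ∃ v ∈ V Ω φ, v.fst ∈ Uᗮ ∧ v ≠ 0 ∧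
    r = (∫ x in (Ω : Set (Rd d)), ‖v.snd x‖ ^ 2) / ∫ x in (Ω : Set (Rd d)), ‖v.fst x‖ ^ 2}

end LimitEigenvalue

end

open LimitEigenvalue

noncomputable section

namespace LimitEigenvalue

variable {d : ℕ}

/-! ### Variational construction of eigenvectors for a compact injective operator. -/

section Abstract

variable {H F : Type*} [NormedAddCommGroup H] [InnerProductSpace ℝ H]
  [NormedAddCommGroup F] [InnerProductSpace ℝ F]

/-! Give `V Ω φ` the full `H¹` inner product and let `T` be its embedding into `L²`. Adding `∫ w η`
to both sides of the weak equation turns it into `⟪w, y⟫ = κ ⟪T w, T y⟫` with `κ = μ + 1`, and the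
Rayleigh quotient becomes `‖v‖² / ‖T v‖² - 1`. Everything except positivity of the eigenvalues then
concerns a bounded operator `T` between Hilbert spaces that is compact, injective and has
infinite-dimensional domain.

For such a `T`, minimize `‖x‖² / ‖T x‖²` successively, each time over the vectors whose image is
orthogonal to the images already found. Minimizers exist because a compact operator attains its norm
(`exists_norm_eq_opNorm_of_isCompactOperator`); their Euler–Lagrange equations are the eigenvalue
equations; and the minima tend to infinity because an orthonormal sequence has no convergent
subsequence. A vector whose image is orthogonal to all `T (w k)` must therefore vanish, which gives
completeness, the expansion and the absence of further eigenvalues. The max-min formula is a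
dimension count (`IsEigensystem.le_of_isLeast`).

The hypotheses on `T` come from analysis. Compactness is Rellich's theorem, proved by showing that
functions whose integrals over all balls of a fine cover vanish are small in `L²` compared with
their gradients. Injectivity is uniqueness of the weak gradient, and disjoint bumps in the given
ball make the domain infinite-dimensional. Finally, `κ > 1` follows from the Poincaré inequality. -/

theorem eq_zero_of_forall_quadratic_nonneg {b c : ℝ} (h : ∀ t : ℝ, 0 ≤ t * b + t ^ 2 * c) :
    b = 0 := by
  -- The constant term is zero, so the discriminant is just `b ^ 2`.
  have h1 := discrim_le_zero (a := c) (b := b) (c := 0) fun t => by nlinarith [h t]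
  rw [discrim] at h1
  nlinarith [sq_nonneg b]

/-- The Euler–Lagrange equation of a minimizer of `‖y‖² / ‖T y‖²` over a subspace. -/
theorem inner_eq_of_isLeast_quotient (T : H →L[ℝ] F) (W : Submodule ℝ H) {x : H} (hxW : x ∈ W)
    (hx : ‖T x‖ = 1) (hmin : ∀ y ∈ W, ‖x‖ ^ 2 * ‖T y‖ ^ 2 ≤ ‖y‖ ^ 2) {y : H} (hy : y ∈ W) :
    inner ℝ x y = ‖x‖ ^ 2 * inner ℝ (T x) (T y) := by
  have : inner ℝ x y - ‖x‖ ^ 2 * inner ℝ (T x) (T y) = 0 := by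
    have h2 := eq_zero_of_forall_quadratic_nonneg
      (b := 2 * (inner ℝ x y - ‖x‖ ^ 2 * inner ℝ (T x) (T y)))
      (c := ‖y‖ ^ 2 - ‖x‖ ^ 2 * ‖T y‖ ^ 2) fun t => by
        have h1 := hmin (x + t • y) (W.add_mem hxW (W.smul_mem t hy))
        rw [map_add, map_smul, norm_add_sq_real, norm_add_sq_real, real_inner_smul_right,
          real_inner_smul_right, norm_smul, norm_smul, hx, mul_pow, mul_pow, Real.norm_eq_abs,
          sq_abs] at h1
        nlinarith
    linarith
  linarith

/-- The subspace of all `x` with `T x` orthogonal to `T w j` for all `j < n`. -/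
def orthoPrev (T : H →L[ℝ] F) (w : ℕ → H) (n : ℕ) : Submodule ℝ H :=
  (Submodule.span ℝ ((fun j => T (w j)) '' Set.Iio n))ᗮ.comap (T : H →ₗ[ℝ] F)

theorem mem_orthoPrev {T : H →L[ℝ] F} {w : ℕ → H} {n : ℕ} {x : H} :
    x ∈ orthoPrev T w n ↔ ∀ j < n, inner ℝ (T (w j)) (T x) = 0 := by
  rw [orthoPrev, Submodule.mem_comap, Submodule.mem_orthogonal]
  constructor
  · intro h j hj
    exact h _ (Submodule.subset_span ⟨j, hj, rfl⟩)
  · intro h u hu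
    induction hu using Submodule.span_induction with
    | mem x hx => obtain ⟨j, hj, rfl⟩ := hx; exact h j hj
    | zero => simp
    | add x y _ _ h1 h2 => rw [inner_add_left, h1, h2, add_zero]
    | smul c x _ h1 => rw [real_inner_smul_left, h1, mul_zero]

theorem isClosed_comap_orthogonal (T : H →L[ℝ] F) (U : Submodule ℝ F) :
    IsClosed (Uᗮ.comap (T : H →ₗ[ℝ] F) : Set H) :=
  U.isClosed_orthogonal.preimage T.continuous

/-- The constraint is the kernel of the projection onto `U` composed with `T`. Were this kernel
trivial, `H` would embed in the finite-dimensional `U`. -/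
theorem comap_orthogonal_ne_bot (T : H →L[ℝ] F) (hinf : ¬ FiniteDimensional ℝ H)
    (U : Submodule ℝ F) [FiniteDimensional ℝ U] : Uᗮ.comap (T : H →ₗ[ℝ] F) ≠ ⊥ := by
  intro h
  refine hinf (FiniteDimensional.of_injective
    ((U.orthogonalProjectionOnto : F →ₗ[ℝ] U).comp (T : H →ₗ[ℝ] F)) ?_)
  rw [← LinearMap.ker_eq_bot, eq_bot_iff, ← h]
  intro x hx
  have hx' : U.orthogonalProjectionOnto (T x) = 0 := hx
  rw [Submodule.orthogonalProjectionOnto_eq_zero_iff] at hx'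
  exact hx'

variable [CompleteSpace H] [CompleteSpace F]

/-- An operator that is small on subspaces of finite codimension is compact. -/
theorem isCompactOperator_of_forall_finite_functionals (T : H →L[ℝ] F)
    (h : ∀ ε > 0, ∃ (n : ℕ) (f : Fin n → H →L[ℝ] ℝ),
      ∀ x, (∀ j, f j x = 0) → ‖T x‖ ≤ ε * ‖x‖) : IsCompactOperator T := by
  have hcl := isClosed_setOfPred_isCompactOperator (𝕜₁ := ℝ) (𝕜₂ := ℝ) (σ₁₂ := RingHom.id ℝ)
    (M₁ := H) (M₂ := F)
  have : T ∈ closure {f : H →L[ℝ] F | IsCompactOperator f} := by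
    rw [Metric.mem_closure_iff]
    intro ε hε
    obtain ⟨n, f, hf⟩ := h (ε / 2) (by positivity)
    set S : H →L[ℝ] (Fin n → ℝ) := ContinuousLinearMap.pi f with hS
    set K : Submodule ℝ H := LinearMap.ker (S : H →ₗ[ℝ] (Fin n → ℝ)) with hK
    have hKc : IsClosed (K : Set H) := S.isClosed_ker
    have : CompleteSpace K := hKc.completeSpace_coe
    -- The finitely many functionals separate the points of `Kᗮ`, since `K` is their common kernel.
    have hfin : FiniteDimensional ℝ Kᗮ := by
      refine FiniteDimensional.of_injective
        ((S : H →ₗ[ℝ] (Fin n → ℝ)).comp Kᗮ.subtype) ?_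
      rw [← LinearMap.ker_eq_bot, LinearMap.ker_eq_bot']
      intro x hx
      have h1 : (x : H) ∈ K := hx
      have h2 := K.inner_right_of_mem_orthogonal h1 x.2
      exact Subtype.ext (inner_self_eq_zero.1 h2)
    -- This finite-rank operator differs from `T` by `T` composed with the projection onto `K`,
    -- where the smallness hypothesis applies.
    refine ⟨T.comp (Kᗮ.subtypeL.comp Kᗮ.orthogonalProjectionOnto), ?_, ?_⟩
    · have h1 : IsCompactOperator (T.comp Kᗮ.subtypeL) :=
        isCompactOperator_of_locallyCompactSpace_rng (T.comp Kᗮ.subtypeL)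
      exact h1.comp_clm Kᗮ.orthogonalProjectionOnto
    · rw [dist_eq_norm]
      refine lt_of_le_of_lt (ContinuousLinearMap.opNorm_le_bound _ (by positivity)
        (M := ε / 2) fun x => ?_) (by linarith)
      have hx : x - Kᗮ.orthogonalProjectionOnto x = K.orthogonalProjectionOnto x := by
        have := K.starProjection_add_starProjection_orthogonal x
        rw [Submodule.starProjection_apply, Submodule.starProjection_apply] at this
        rw [sub_eq_iff_eq_add, this]
      have h2 : (T - T.comp (Kᗮ.subtypeL.comp Kᗮ.orthogonalProjectionOnto)) x
          = T (K.orthogonalProjectionOnto x) := by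
        rw [← hx]; simp
      rw [h2]
      refine (hf _ fun j => ?_).trans ?_
      · have h3 : S (K.orthogonalProjectionOnto x) = 0 := (K.orthogonalProjectionOnto x).2
        exact congrFun h3 j
      · gcongr
        exact K.norm_orthogonalProjectionOnto_apply_le x
  rwa [hcl.closure_eq] at this

/-- A compact operator between Hilbert spaces attains its norm. -/
theorem exists_norm_eq_opNorm_of_isCompactOperator [Nontrivial H] (T : H →L[ℝ] F)
    (hT : IsCompactOperator T) : ∃ x, ‖x‖ = 1 ∧ ‖T x‖ = ‖T‖ := by
  by_cases h0 : ‖T‖ = 0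
  · obtain ⟨x, hx⟩ := exists_norm_eq H zero_le_one
    refine ⟨x, hx, ?_⟩
    rw [norm_eq_zero] at h0
    simp [h0]
  have hpos : 0 < ‖T‖ := lt_of_le_of_ne (norm_nonneg _) (Ne.symm h0)
  have hx : ∀ n : ℕ, ∃ x, ‖x‖ = 1 ∧ ‖T‖ * (1 - 1 / (n + 2 : ℝ)) < ‖T x‖ := by
    intro n
    have h2 : (0 : ℝ) < 1 / (n + 2 : ℝ) := by positivity
    have h1 : 1 / (n + 2 : ℝ) < 1 := by
      rw [div_lt_one (by positivity)]; linarith [(Nat.cast_nonneg n : (0 : ℝ) ≤ n)]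
    obtain ⟨x, hx⟩ := T.exists_mul_lt_of_lt_opNorm
      (r := ‖T‖ * (1 - 1 / (n + 2 : ℝ))) (by nlinarith) (by nlinarith)
    have hx0 : x ≠ 0 := by
      rintro rfl
      simp at hx
    refine ⟨‖x‖⁻¹ • x, ?_, ?_⟩
    · rw [norm_smul, norm_inv, norm_norm, inv_mul_cancel₀ (norm_ne_zero_iff.2 hx0)]
    rw [map_smul, norm_smul, norm_inv, norm_norm, inv_mul_eq_div, lt_div_iff₀ (norm_pos_iff.2 hx0)]
    exact hx
  choose x hx1 hxT using hx
  have hlim : Tendsto (fun n => ‖T (x n)‖) atTop (𝓝 ‖T‖) := by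
    refine tendsto_of_tendsto_of_tendsto_of_le_of_le (g := fun n : ℕ => ‖T‖ * (1 - 1 / (n + 2 : ℝ)))
      (h := fun _ => ‖T‖) ?_ tendsto_const_nhds (fun n => (hxT n).le) fun n => ?_
    · have : Tendsto (fun n : ℕ => 1 / (n + 2 : ℝ)) atTop (𝓝 0) := by
        have := (tendsto_const_div_atTop_nhds_zero_nat (1 : ℝ)).comp (tendsto_add_atTop_nat 2)
        simpa [Function.comp_def] using this
      simpa using (this.const_sub 1).const_mul ‖T‖
    · simpa [hx1 n] using T.le_opNorm (x n)
  have hcomp := hT.isCompact_closure_image_closedBall (r := 1)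
  obtain ⟨y, -, σ, hσ, hy⟩ := hcomp.tendsto_subseq (x := fun n => T (x n)) fun n =>
    subset_closure ⟨x n, by simp [hx1 n], rfl⟩
  have hlim' := hlim.comp hσ.tendsto_atTop
  set A := ContinuousLinearMap.adjoint T with hA
  have hz : Tendsto (fun n => A (T (x (σ n)))) atTop (𝓝 (A y)) :=
    (A.continuous.tendsto y).comp hy
  -- Maximizing unit vectors are approximate eigenvectors of `T* T` for `‖T‖²`: expand the square.
  -- As `A (T (x (σ n)))` converges, so does `x (σ n)`, strongly, and no weak compactness is needed.
  have hdiff : Tendsto (fun n => A (T (x (σ n))) - ‖T‖ ^ 2 • x (σ n)) atTop (𝓝 0) := by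
    rw [tendsto_zero_iff_norm_tendsto_zero]
    have hb : ∀ n, ‖A (T (x (σ n))) - ‖T‖ ^ 2 • x (σ n)‖ ^ 2
        ≤ 2 * ‖T‖ ^ 2 * (‖T‖ ^ 2 - ‖T (x (σ n))‖ ^ 2) := by
      intro n
      have e1 : inner ℝ (A (T (x (σ n)))) (x (σ n)) = ‖T (x (σ n))‖ ^ 2 := by
        rw [hA, ContinuousLinearMap.adjoint_inner_left, real_inner_self_eq_norm_sq]
      have e2 : ‖A (T (x (σ n)))‖ ≤ ‖T‖ * ‖T (x (σ n))‖ := by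
        have := A.le_opNorm (T (x (σ n)))
        rwa [hA, ContinuousLinearMap.adjoint.norm_map] at this
      have e3 : ‖T (x (σ n))‖ ≤ ‖T‖ := by simpa [hx1] using T.le_opNorm (x (σ n))
      rw [norm_sub_sq_real, real_inner_smul_right, e1, norm_smul, hx1]
      have e4 : ‖A (T (x (σ n)))‖ ^ 2 ≤ (‖T‖ * ‖T‖) ^ 2 := by
        have : ‖T‖ * ‖T (x (σ n))‖ ≤ ‖T‖ * ‖T‖ := by gcongr
        gcongr
        exact e2.trans this
      have e5 : ‖‖T‖ ^ 2‖ = ‖T‖ ^ 2 := by simp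
      rw [e5]
      nlinarith
    have h0 : Tendsto (fun n => 2 * ‖T‖ ^ 2 * (‖T‖ ^ 2 - ‖T (x (σ n))‖ ^ 2)) atTop (𝓝 0) := by
      have := ((hlim'.pow 2).const_sub (‖T‖ ^ 2)).const_mul (2 * ‖T‖ ^ 2)
      rwa [sub_self, mul_zero] at this
    have h1 := squeeze_zero (fun n => sq_nonneg _) hb h0
    simpa using h1.sqrt
  have hx' : Tendsto (fun n => x (σ n)) atTop (𝓝 ((‖T‖ ^ 2)⁻¹ • A y)) := by
    have := (hz.sub hdiff).const_smul ((‖T‖ ^ 2)⁻¹)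
    have hne : ‖T‖ ^ 2 ≠ 0 := by positivity
    simpa [smul_smul, inv_mul_cancel₀ hne] using this
  refine ⟨(‖T‖ ^ 2)⁻¹ • A y, ?_, ?_⟩
  · exact tendsto_nhds_unique hx'.norm (by simp [hx1])
  · exact tendsto_nhds_unique ((T.continuous.tendsto _).comp hx').norm hlim'

/-- The maximum of `‖T y‖ / ‖y‖` over a nontrivial closed subspace is attained, at a vector
normalized by `‖T x‖ = 1`. -/
theorem exists_isLeast_quotient (T : H →L[ℝ] F) (hT : IsCompactOperator T)
    (hinj : Function.Injective T) (W : Submodule ℝ H) (hW : IsClosed (W : Set H)) (hW0 : W ≠ ⊥) :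
    ∃ x ∈ W, ‖T x‖ = 1 ∧ ∀ y ∈ W, ‖x‖ ^ 2 * ‖T y‖ ^ 2 ≤ ‖y‖ ^ 2 := by
  have : CompleteSpace W := hW.completeSpace_coe
  have : Nontrivial W := (Submodule.nontrivial_iff_ne_bot).2 hW0
  obtain ⟨x, hx1, hx⟩ := exists_norm_eq_opNorm_of_isCompactOperator (T.comp W.subtypeL)
    (hT.comp_clm W.subtypeL)
  set M := ‖T.comp W.subtypeL‖
  have hTx : ‖T (x : H)‖ = M := hx
  have hM : 0 < M := by
    rw [← hTx, norm_pos_iff]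
    intro h
    have h2 : (x : H) = 0 := hinj (by rw [h, map_zero])
    have : x = 0 := Subtype.ext h2
    rw [this] at hx1
    simp at hx1
  refine ⟨M⁻¹ • (x : H), W.smul_mem _ x.2, ?_, fun y hy => ?_⟩
  · rw [map_smul, norm_smul, hTx, norm_inv, Real.norm_of_nonneg hM.le, inv_mul_cancel₀ hM.ne']
  · have h1 : ‖T y‖ ≤ M * ‖y‖ := (T.comp W.subtypeL).le_opNorm ⟨y, hy⟩
    have h2 : ‖M⁻¹ • (x : H)‖ = M⁻¹ := by
      rw [norm_smul, norm_inv, Real.norm_of_nonneg hM.le]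
      have : ‖(x : H)‖ = 1 := hx1
      rw [this, mul_one]
    rw [h2, ← mul_pow]
    gcongr
    rw [inv_mul_le_iff₀ hM]
    exact h1

/-- A sequence of successive minimizers of `‖x‖² / ‖T x‖²`. -/
theorem exists_seq_minimizers (T : H →L[ℝ] F) (hT : IsCompactOperator T)
    (hinj : Function.Injective T) (hinf : ¬ FiniteDimensional ℝ H) :
    ∃ w : ℕ → H, ∀ n, w n ∈ orthoPrev T w n ∧ ‖T (w n)‖ = 1 ∧
      ∀ y ∈ orthoPrev T w n, ‖w n‖ ^ 2 * ‖T y‖ ^ 2 ≤ ‖y‖ ^ 2 := by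
  have hch : ∀ W : Submodule ℝ H, ∃ x, IsClosed (W : Set H) → W ≠ ⊥ →
      x ∈ W ∧ ‖T x‖ = 1 ∧ ∀ y ∈ W, ‖x‖ ^ 2 * ‖T y‖ ^ 2 ≤ ‖y‖ ^ 2 := by
    intro W
    by_cases h : IsClosed (W : Set H) ∧ W ≠ ⊥
    · obtain ⟨x, h1, h2⟩ := exists_isLeast_quotient T hT hinj W h.1 h.2
      exact ⟨x, fun _ _ => ⟨h1, h2⟩⟩
    · exact ⟨0, fun h1 h2 => absurd ⟨h1, h2⟩ h⟩
  -- `g` picks a minimizer for every subspace, with the default value `0` when the subspace is not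
  -- closed or is trivial. The recursion can then run on constraint subspaces alone, each determined
  -- by its predecessor.
  choose g hg using hch
  let next : Submodule ℝ H → Submodule ℝ H := fun W =>
    W ⊓ (Submodule.span ℝ {T (g W)})ᗮ.comap (T : H →ₗ[ℝ] F)
  let W : ℕ → Submodule ℝ H := fun n => Nat.rec ⊤ (fun _ => next) n
  have hW : ∀ n, W n = orthoPrev T (fun j => g (W j)) n := by
    intro n
    ext x
    rw [mem_orthoPrev]
    induction n with
    | zero => simp [W]
    | succ n ih =>
      have h1 : x ∈ W (n + 1) ↔ x ∈ W n ∧ inner ℝ (T (g (W n))) (T x) = 0 := by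
        change x ∈ W n ∧ T x ∈ (Submodule.span ℝ {T (g (W n))})ᗮ ↔ _
        rw [Submodule.mem_orthogonal_singleton_iff_inner_right]
      rw [h1, ih]
      constructor
      · rintro ⟨h2, h3⟩ j hj
        rcases Nat.lt_succ_iff_lt_or_eq.1 hj with h | rfl
        · exact h2 j h
        · exact h3
      · exact fun h => ⟨fun j hj => h j (by omega), h n (by omega)⟩
  refine ⟨fun j => g (W j), fun n => ?_⟩
  rw [← hW]
  refine hg (W n) ?_ ?_
  · rw [hW]; exact isClosed_comap_orthogonal T _
  · rw [hW]
    have : FiniteDimensional ℝ (Submodule.span ℝ ((fun j => T (g (W j))) '' Set.Iio n)) :=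
      FiniteDimensional.span_of_finite ℝ ((Set.finite_Iio n).image _)
    exact comap_orthogonal_ne_bot T hinf _

/-- `w` is a complete system of successive eigenvectors of `⟪w, y⟫ = κ ⟪T w, T y⟫`. -/
structure IsEigensystem (T : H →L[ℝ] F) (w : ℕ → H) (κ : ℕ → ℝ) : Prop where
  orthonormal : Orthonormal ℝ fun k => T (w k)
  inner_eq : ∀ k y, inner ℝ (w k) y = κ k * inner ℝ (T (w k)) (T y)
  mono : Monotone κ
  tendsto : Tendsto κ atTop atTop
  pos : ∀ k, 0 < κ k
  le : ∀ k, ∀ y ∈ orthoPrev T w k, κ k * ‖T y‖ ^ 2 ≤ ‖y‖ ^ 2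

theorem exists_isEigensystem (T : H →L[ℝ] F) (hT : IsCompactOperator T)
    (hinj : Function.Injective T) (hinf : ¬ FiniteDimensional ℝ H) :
    ∃ w κ, IsEigensystem T w κ := by
  obtain ⟨w, hw⟩ := exists_seq_minimizers T hT hinj hinf
  have hTorth : ∀ j k, j < k → inner ℝ (T (w j)) (T (w k)) = 0 := fun j k hjk =>
    mem_orthoPrev.1 (hw k).1 j hjk
  have horth : Orthonormal ℝ fun k => T (w k) := by
    refine ⟨fun k => (hw k).2.1, fun j k hjk => ?_⟩
    rcases lt_or_gt_of_ne hjk with h | h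
    · exact hTorth j k h
    · rw [real_inner_comm]; exact hTorth k j h
  have hanti : ∀ {j k}, j ≤ k → orthoPrev T w k ≤ orthoPrev T w j := fun hjk x hx =>
    mem_orthoPrev.2 fun i hi => mem_orthoPrev.1 hx i (hi.trans_le hjk)
  have hEL : ∀ k, ∀ y ∈ orthoPrev T w k,
      inner ℝ (w k) y = ‖w k‖ ^ 2 * inner ℝ (T (w k)) (T y) := fun k y hy =>
    inner_eq_of_isLeast_quotient T _ (hw k).1 (hw k).2.1 (hw k).2.2 hy
  have hworth : ∀ j k, j < k → inner ℝ (w j) (w k) = 0 := fun j k hjk => by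
    rw [hEL j _ (hanti hjk.le (hw k).1), hTorth j k hjk, mul_zero]
  -- To remove the constraint on `y`, subtract its component `p` along the earlier minimizers. Both
  -- sides vanish on `p`, because `w k` is orthogonal to them in `H` and `T (w k)` to their images
  -- in `F`.
  have hinner : ∀ k y, inner ℝ (w k) y = ‖w k‖ ^ 2 * inner ℝ (T (w k)) (T y) := by
    intro k y
    set p := ∑ j ∈ Finset.range k, inner ℝ (T (w j)) (T y) • w j with hp
    have h1 : y - p ∈ orthoPrev T w k := by
      rw [mem_orthoPrev]
      intro j hj
      have : T p = ∑ j ∈ Finset.range k, inner ℝ (T (w j)) (T y) • T (w j) := by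
        simp [hp, map_sum]
      rw [map_sub, inner_sub_right, this,
        horth.inner_right_sum (fun j => inner ℝ (T (w j)) (T y)) (Finset.mem_range.2 hj), sub_self]
    have h2 : inner ℝ (w k) p = 0 := by
      rw [hp, inner_sum]
      refine Finset.sum_eq_zero fun j hj => ?_
      rw [real_inner_smul_right, real_inner_comm (w j), hworth j k (Finset.mem_range.1 hj), mul_zero]
    have h3 : inner ℝ (T (w k)) (T p) = 0 := by
      rw [hp, map_sum, inner_sum]
      refine Finset.sum_eq_zero fun j hj => ?_
      rw [map_smul, real_inner_smul_right, real_inner_comm (T (w j)), hTorth j k (Finset.mem_range.1 hj),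
        mul_zero]
    have h4 := hEL k _ h1
    rw [map_sub, inner_sub_right, inner_sub_right, h2, h3] at h4
    simpa using h4
  have hmono : Monotone fun k => ‖w k‖ ^ 2 := fun j k hjk => by
    have := (hw j).2.2 _ (hanti hjk (hw k).1)
    rw [(hw k).2.1] at this
    simpa using this
  have hne : ∀ k, w k ≠ 0 := fun k h => by
    have := (hw k).2.1
    rw [h] at this
    simp at this
  refine ⟨w, fun k => ‖w k‖ ^ 2, horth, hinner, hmono, ?_,
    fun k => by have := norm_pos_iff.2 (hne k); positivity, fun k => (hw k).2.2⟩
  refine (tendsto_atTop_atTop_iff_of_monotone hmono).2 fun C => ?_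
  -- Bounded minima would make the `w k` bounded, so their images would have a convergent
  -- subsequence; but orthonormal images stay at distance `√2` from each other.
  by_contra! hC
  have hb : ∀ k, ‖w k‖ ≤ Real.sqrt C := fun k => Real.le_sqrt_of_sq_le (hC k).le
  have hcomp := hT.isCompact_closure_image_closedBall (r := Real.sqrt C)
  obtain ⟨y, -, σ, hσ, hy⟩ := hcomp.tendsto_subseq (x := fun n => T (w n)) fun n =>
    subset_closure ⟨w n, by simpa using hb n, rfl⟩
  obtain ⟨N, hN⟩ := (Metric.cauchySeq_iff.1 hy.cauchySeq) 1 one_pos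
  have h1 := hN N le_rfl (N + 1) (by omega)
  have h2 : ‖T (w (σ N)) - T (w (σ (N + 1)))‖ ^ 2 = 2 := by
    rw [norm_sub_sq_real, (hw _).2.1, (hw _).2.1, hTorth _ _ (hσ (Nat.lt_succ_self N))]
    norm_num
  simp only [Function.comp_apply, dist_eq_norm] at h1
  nlinarith [norm_nonneg (T (w (σ N)) - T (w (σ (N + 1))))]

end Abstract

/-! ### Completeness, expansion and multiplicities. -/

section Eigensystem

variable {H F : Type*} [NormedAddCommGroup H] [InnerProductSpace ℝ H]
  [NormedAddCommGroup F] [InnerProductSpace ℝ F] {T : H →L[ℝ] F} {w : ℕ → H} {κ : ℕ → ℝ}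

namespace IsEigensystem

theorem inner_eigenvectors (E : IsEigensystem T w κ) (j k : ℕ) :
    inner ℝ (w j) (w k) = if j = k then κ j else 0 := by
  rw [E.inner_eq, orthonormal_iff_ite.1 E.orthonormal j k]
  split_ifs <;> simp

/-- The eigenvectors, normalized in the norm of the domain. -/
theorem orthonormal_normalized (E : IsEigensystem T w κ) :
    Orthonormal ℝ fun k => (Real.sqrt (κ k))⁻¹ • w k := by
  rw [orthonormal_iff_ite]
  intro j k
  rw [real_inner_smul_left, real_inner_smul_right, E.inner_eigenvectors]
  split_ifs with h
  · subst h
    have h1 := Real.sqrt_pos.2 (E.pos j)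
    field_simp
    exact (Real.sq_sqrt (E.pos j).le).symm
  · simp

/-- Such a `u` is admissible in every minimization, so its quotient would dominate every `κ k`,
while these are unbounded. -/
theorem eq_zero_of_forall_inner_eq_zero (E : IsEigensystem T w κ) (hinj : Function.Injective T)
    {u : H} (hu : ∀ k, inner ℝ (T (w k)) (T u) = 0) : u = 0 := by
  have h1 : ∀ k, κ k * ‖T u‖ ^ 2 ≤ ‖u‖ ^ 2 := fun k =>
    E.le k u (mem_orthoPrev.2 fun j _ => hu j)
  have h2 : T u = 0 := by
    by_contra hne
    have hpos : 0 < ‖T u‖ ^ 2 := by have := norm_pos_iff.2 hne; positivity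
    obtain ⟨k, hk⟩ := (E.tendsto.eventually_gt_atTop (‖u‖ ^ 2 / ‖T u‖ ^ 2)).exists
    rw [div_lt_iff₀ hpos] at hk
    linarith [h1 k]
  exact hinj (by rw [h2, map_zero])

/-- The vectors `w k / √(κ k)` form a Hilbert basis of `H`. The eigenvalue equation contributes a
factor `κ k` to each Fourier coefficient, which cancels the two normalizing square roots. -/
theorem hasSum [CompleteSpace H] (E : IsEigensystem T w κ) (hinj : Function.Injective T) (u : H) :
    HasSum (fun k => inner ℝ (T u) (T (w k)) • w k) u := by
  have hsp : (Submodule.span ℝ (Set.range fun k => (Real.sqrt (κ k))⁻¹ • w k))ᗮ = ⊥ := by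
    rw [eq_bot_iff]
    intro u hu
    refine E.eq_zero_of_forall_inner_eq_zero hinj fun k => ?_
    have h1 := (Submodule.mem_orthogonal _ _).1 hu _ (Submodule.subset_span ⟨k, rfl⟩)
    rw [real_inner_smul_left, E.inner_eq] at h1
    simpa [(Real.sqrt_pos.2 (E.pos k)).ne', (E.pos k).ne'] using h1
  have h := (HilbertBasis.mkOfOrthogonalEqBot E.orthonormal_normalized hsp).hasSum_repr u
  refine h.congr_fun fun k => ?_
  rw [HilbertBasis.repr_apply_apply, HilbertBasis.coe_mkOfOrthogonalEqBot]
  rw [real_inner_smul_left, E.inner_eq, smul_smul, real_inner_comm]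
  congr 1
  have h1 := Real.sqrt_pos.2 (E.pos k)
  field_simp
  rw [Real.sq_sqrt (E.pos k).le]

/-- Testing each eigenvalue equation with the other eigenvector gives `(κ k - μ) ⟪T (w k), T v⟫ =
0`; if `μ` is none of the `κ k`, completeness forces `v = 0`. -/
theorem exists_eigenvalue_eq (E : IsEigensystem T w κ) (hinj : Function.Injective T) {v : H}
    (hv0 : v ≠ 0) {μ : ℝ} (hv : ∀ y, inner ℝ v y = μ * inner ℝ (T v) (T y)) : ∃ k, κ k = μ := by
  by_contra! hne
  refine hv0 (E.eq_zero_of_forall_inner_eq_zero hinj fun k => ?_)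
  have h1 := hv (w k)
  rw [real_inner_comm, E.inner_eq, real_inner_comm (T (w k)) (T v)] at h1
  have h2 : (κ k - μ) * inner ℝ (T (w k)) (T v) = 0 := by
    rw [sub_mul, h1, sub_self]
  exact (mul_eq_zero.1 h2).resolve_left (sub_ne_zero.2 (hne k))

theorem finite_setOf_eq (E : IsEigensystem T w κ) (μ : ℝ) : {j | κ j = μ}.Finite := by
  obtain ⟨N, hN⟩ := (E.tendsto.eventually_gt_atTop μ).exists_forall_of_atTop
  refine (Set.finite_Iio N).subset fun j hj => ?_
  by_contra h
  exact (hN j (not_lt.1 h)).ne' hj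

/-- By the same symmetry argument, the expansion of `v` keeps only the finitely many terms with `κ k
= μ`. -/
theorem mem_span_of_eigenvector [CompleteSpace H] (E : IsEigensystem T w κ)
    (hinj : Function.Injective T) {v : H} {μ : ℝ}
    (hv : ∀ y, inner ℝ v y = μ * inner ℝ (T v) (T y)) :
    v ∈ Submodule.span ℝ (w '' {j | κ j = μ}) := by
  have h0 : ∀ k, κ k ≠ μ → inner ℝ (T v) (T (w k)) = 0 := fun k hk => by
    have h1 := hv (w k)
    rw [real_inner_comm, E.inner_eq, real_inner_comm] at h1
    have h2 : (κ k - μ) * inner ℝ (T v) (T (w k)) = 0 := by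
      rw [sub_mul, h1, sub_self]
    exact (mul_eq_zero.1 h2).resolve_left (sub_ne_zero.2 hk)
  rw [(E.hasSum hinj v).unique (hasSum_sum_of_ne_finset_zero
    (s := (E.finite_setOf_eq μ).toFinset) fun k hk => by
      rw [h0 k (by simpa using hk), zero_smul])]
  exact Submodule.sum_mem _ fun k hk => Submodule.smul_mem _ _
    (Submodule.subset_span ⟨k, by simpa using hk, rfl⟩)

theorem linearIndependent (E : IsEigensystem T w κ) : LinearIndependent ℝ w :=
  LinearIndependent.of_comp (T : H →ₗ[ℝ] F) E.orthonormal.linearIndependent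

end IsEigensystem

/-! ### The max-min principle. -/

/-- The values of `‖v‖² / ‖T v‖²` over all `v ≠ 0` with `T v` orthogonal to `U`. -/
def quotientValues (T : H →L[ℝ] F) (U : Submodule ℝ F) : Set ℝ :=
  {r | ∃ v, T v ∈ Uᗮ ∧ v ≠ 0 ∧ r = ‖v‖ ^ 2 / ‖T v‖ ^ 2}

theorem exists_isLeast_quotientValues [CompleteSpace H] [CompleteSpace F]
    (hT : IsCompactOperator T) (hinj : Function.Injective T) (hinf : ¬ FiniteDimensional ℝ H)
    (U : Submodule ℝ F) [FiniteDimensional ℝ U] : ∃ m, IsLeast (quotientValues T U) m := by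
  obtain ⟨x, hxU, hx, hmin⟩ := exists_isLeast_quotient T hT hinj _ (isClosed_comap_orthogonal T U)
    (comap_orthogonal_ne_bot T hinf U)
  refine ⟨‖x‖ ^ 2, ⟨x, hxU, ?_, by simp [hx]⟩, ?_⟩
  · rintro rfl
    simp at hx
  · rintro r ⟨v, hvU, hv, rfl⟩
    have : 0 < ‖T v‖ := norm_pos_iff.2 fun h => hv (hinj (by rw [h, map_zero]))
    rw [le_div_iff₀ (by positivity)]
    exact hmin v hvU

namespace IsEigensystem

theorem finrank_span_Iio (E : IsEigensystem T w κ) (k : ℕ) :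
    FiniteDimensional ℝ (Submodule.span ℝ ((fun j => T (w j)) '' Set.Iio k)) ∧
    Module.finrank ℝ (Submodule.span ℝ ((fun j => T (w j)) '' Set.Iio k)) = k := by
  refine ⟨FiniteDimensional.span_of_finite ℝ ((Set.finite_Iio k).image _), ?_⟩
  have h := finrank_span_eq_card
    (E.orthonormal.linearIndependent.comp (fun j : Set.Iio k => (j : ℕ)) Subtype.val_injective)
  rw [Set.range_comp, Subtype.range_coe] at h
  simpa using h

theorem isLeast_span (E : IsEigensystem T w κ) (hinj : Function.Injective T) (k : ℕ) :
    IsLeast (quotientValues T (Submodule.span ℝ ((fun j => T (w j)) '' Set.Iio k))) (κ k) := by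
  have hk : ‖T (w k)‖ = 1 := E.orthonormal.1 k
  have hn : ‖w k‖ ^ 2 = κ k := by
    rw [← real_inner_self_eq_norm_sq, E.inner_eigenvectors, if_pos rfl]
  refine ⟨⟨w k, ?_, ?_, by rw [hk, hn]; simp⟩, ?_⟩
  · have h : w k ∈ orthoPrev T w k := mem_orthoPrev.2 fun j hj => by
      rw [orthonormal_iff_ite.1 E.orthonormal j k, if_neg hj.ne]
    exact h
  · intro h
    rw [h] at hk
    simp at hk
  · rintro r ⟨v, hvU, hv, rfl⟩
    have : 0 < ‖T v‖ := norm_pos_iff.2 fun h => hv (hinj (by rw [h, map_zero]))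
    rw [le_div_iff₀ (by positivity)]
    exact E.le k v hvU

/-- The span of `w 0, …, w k` has dimension `k + 1`, one more than `U`, so it contains a nonzero
vector whose image is orthogonal to `U`. On that span the quotient is a weighted mean of `κ 0, …, κ
k`, hence at most `κ k`. -/
theorem le_of_isLeast (E : IsEigensystem T w κ) {k : ℕ} {U : Submodule ℝ F}
    [FiniteDimensional ℝ U] (hU : Module.finrank ℝ U = k) {m : ℝ}
    (hm : IsLeast (quotientValues T U) m) : m ≤ κ k := by
  let g : (Fin (k + 1) → ℝ) →ₗ[ℝ] H := Fintype.linearCombination ℝ fun j : Fin (k + 1) => w j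
  have hg : ∀ c, g c = ∑ j, c j • w j := fun c => Fintype.linearCombination_apply ℝ _ c
  have hker : LinearMap.ker ((U.orthogonalProjectionOnto : F →ₗ[ℝ] U) ∘ₗ (T : H →ₗ[ℝ] F) ∘ₗ g)
      ≠ ⊥ := LinearMap.ker_ne_bot_of_finrank_lt (by simp [hU])
  obtain ⟨c, hc, hc0⟩ := Submodule.exists_mem_ne_zero_of_ne_bot hker
  have hcU : T (g c) ∈ Uᗮ := Submodule.orthogonalProjectionOnto_eq_zero_iff.1 hc
  have horth : Orthonormal ℝ fun j : Fin (k + 1) => T (w j) :=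
    E.orthonormal.comp _ Fin.val_injective
  have hTg : T (g c) = ∑ j, c j • T (w j) := by simp [hg]
  have h1 : ‖T (g c)‖ ^ 2 = ∑ j, c j ^ 2 := by
    rw [← real_inner_self_eq_norm_sq, hTg, horth.inner_sum]
    simp [sq]
  have h2 : ‖g c‖ ^ 2 = ∑ j : Fin (k + 1), κ j * c j ^ 2 := by
    rw [← real_inner_self_eq_norm_sq]
    nth_rewrite 1 [hg]
    rw [sum_inner]
    refine Finset.sum_congr rfl fun j _ => ?_
    rw [real_inner_smul_left, E.inner_eq, hTg, horth.inner_right_fintype]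
    ring
  have h3 : 0 < ‖T (g c)‖ ^ 2 := by
    rw [h1]
    obtain ⟨j, hj⟩ := Function.ne_iff.1 hc0
    exact Finset.sum_pos' (fun i _ => sq_nonneg _) ⟨j, Finset.mem_univ _, by
      have : c j ≠ 0 := hj
      positivity⟩
  refine (hm.2 ⟨g c, hcU, ?_, rfl⟩).trans ?_
  · intro h
    rw [h] at h3
    simp at h3
  · rw [div_le_iff₀ h3, h1, h2, Finset.mul_sum]
    refine Finset.sum_le_sum fun j _ => ?_
    exact mul_le_mul_of_nonneg_right (E.mono (Nat.lt_succ_iff.1 j.2)) (sq_nonneg _)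

end IsEigensystem

end Eigensystem

/-! ### Translation estimates and a local averaging inequality. -/

section Translation

open scoped ENNReal

/-- The Cauchy–Schwarz inequality against the constant function. -/
theorem lintegral_sq_le {α : Type*} [MeasurableSpace α] (μ : Measure α) {f : α → ℝ≥0∞}
    (hf : AEMeasurable f μ) : (∫⁻ a, f a ∂μ) ^ 2 ≤ μ Set.univ * ∫⁻ a, f a ^ 2 ∂μ := by
  have h := ENNReal.lintegral_mul_le_Lp_mul_Lq μ (p := 2) (q := 2)
    (Real.holderConjugate_iff.2 ⟨by norm_num, by norm_num⟩) (f := fun _ => 1) (g := f)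
    aemeasurable_const hf
  have h2 : ∀ c : ℝ≥0∞, (c ^ (1 / 2 : ℝ)) ^ 2 = c := fun c => by
    rw [← ENNReal.rpow_natCast, ← ENNReal.rpow_mul]; norm_num
  have h' := pow_le_pow_left' h 2
  rw [mul_pow, h2, h2] at h'
  simpa using h'

/-- Replacing both terms by the larger one gives `4` instead of the optimal `2`, which is harmless
here. -/
theorem add_sq_le_four_mul (a b : ℝ≥0∞) : (a + b) ^ 2 ≤ 4 * a ^ 2 + 4 * b ^ 2 := by
  have h4 : ∀ c : ℝ≥0∞, (c + c) ^ 2 = 4 * c ^ 2 := fun c => by ring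
  rcases le_total a b with h | h
  · calc (a + b) ^ 2 ≤ (b + b) ^ 2 := by gcongr
      _ ≤ _ := by rw [h4]; exact le_add_self
  · calc (a + b) ^ 2 ≤ (a + a) ^ 2 := by gcongr
      _ ≤ _ := by rw [h4]; exact le_self_add

variable {E : Type*} [NormedAddCommGroup E] [NormedSpace ℝ E]

/-- The fundamental theorem of calculus along the segment from `x` to `x + z`, then Cauchy–Schwarz
on `[0, 1]`. -/
theorem enorm_translate_sub_sq_le {ψ : E → ℝ} (hψ : ContDiff ℝ 1 ψ) (x z : E) :
    ‖ψ (x + z) - ψ x‖ₑ ^ 2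
      ≤ ‖z‖ₑ ^ 2 * ∫⁻ t in Set.Icc (0 : ℝ) 1, ‖fderiv ℝ ψ (x + t • z)‖ₑ ^ 2 := by
  have hc : Continuous fun t : ℝ => fderiv ℝ ψ (x + t • z) :=
    (hψ.continuous_fderiv (by simp)).comp (by fun_prop)
  have hc' : Continuous fun t : ℝ => fderiv ℝ ψ (x + t • z) z := hc.clm_apply continuous_const
  have hd : ∀ t : ℝ, HasDerivAt (fun t : ℝ => ψ (x + t • z)) (fderiv ℝ ψ (x + t • z) z) t := by
    intro t
    have h1 : HasDerivAt (fun t : ℝ => x + t • z) z t := by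
      simpa using ((hasDerivAt_id t).smul_const z).const_add x
    exact ((hψ.differentiable (by simp)).differentiableAt.hasFDerivAt).comp_hasDerivAt t h1
  have hFTC := intervalIntegral.integral_eq_sub_of_hasDerivAt (a := 0) (b := 1)
    (fun t _ => hd t) (hc'.intervalIntegrable 0 1)
  simp only [one_smul, zero_smul, add_zero] at hFTC
  have h1 : ‖ψ (x + z) - ψ x‖ₑ
      ≤ ∫⁻ t in Set.Icc (0 : ℝ) 1, ‖z‖ₑ * ‖fderiv ℝ ψ (x + t • z)‖ₑ := by
    rw [← hFTC, intervalIntegral.integral_of_le zero_le_one, ← integral_Icc_eq_integral_Ioc]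
    refine (enorm_integral_le_lintegral_enorm _).trans (lintegral_mono fun t => ?_)
    rw [mul_comm]
    exact ContinuousLinearMap.le_opENorm _ _
  calc ‖ψ (x + z) - ψ x‖ₑ ^ 2
      ≤ (∫⁻ t in Set.Icc (0 : ℝ) 1, ‖z‖ₑ * ‖fderiv ℝ ψ (x + t • z)‖ₑ) ^ 2 := by gcongr
    _ = ‖z‖ₑ ^ 2 * (∫⁻ t in Set.Icc (0 : ℝ) 1, ‖fderiv ℝ ψ (x + t • z)‖ₑ) ^ 2 := by
        rw [lintegral_const_mul' _ _ (by simp), mul_pow]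
    _ ≤ _ := by
        gcongr
        refine (lintegral_sq_le _ hc.enorm.measurable.aemeasurable).trans ?_
        simp

variable [MeasurableSpace E] [BorelSpace E] [FiniteDimensional ℝ E] (μ : Measure E)
  [μ.IsAddHaarMeasure]

/-- Integrate the pointwise bound and exchange integrals; by translation invariance the inner
integral does not depend on `t`. -/
theorem lintegral_enorm_translate_sub_sq_le {ψ : E → ℝ} (hψ : ContDiff ℝ 1 ψ) (z : E) :
    ∫⁻ x, ‖ψ (x + z) - ψ x‖ₑ ^ 2 ∂μ ≤ ‖z‖ₑ ^ 2 * ∫⁻ x, ‖fderiv ℝ ψ x‖ₑ ^ 2 ∂μ := by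
  have hc : Continuous (fderiv ℝ ψ) := hψ.continuous_fderiv (by simp)
  calc ∫⁻ x, ‖ψ (x + z) - ψ x‖ₑ ^ 2 ∂μ
      ≤ ∫⁻ x, (‖z‖ₑ ^ 2 * ∫⁻ t in Set.Icc (0 : ℝ) 1, ‖fderiv ℝ ψ (x + t • z)‖ₑ ^ 2) ∂μ :=
        lintegral_mono fun x => enorm_translate_sub_sq_le hψ x z
    _ = ‖z‖ₑ ^ 2 * ∫⁻ x, (∫⁻ t in Set.Icc (0 : ℝ) 1, ‖fderiv ℝ ψ (x + t • z)‖ₑ ^ 2) ∂μ :=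
        lintegral_const_mul' _ _ (by simp)
    _ = ‖z‖ₑ ^ 2 * ∫⁻ t in Set.Icc (0 : ℝ) 1, (∫⁻ x, ‖fderiv ℝ ψ (x + t • z)‖ₑ ^ 2 ∂μ) := by
        rw [lintegral_lintegral_swap]
        refine Measurable.aemeasurable ?_
        refine Continuous.measurable ?_
        exact (ENNReal.continuous_pow 2).comp (hc.comp (by fun_prop :
          Continuous fun p : E × ℝ => p.1 + p.2 • z)).enorm
    _ = _ := by
        congr 1
        have : ∀ t : ℝ, ∫⁻ x, ‖fderiv ℝ ψ (x + t • z)‖ₑ ^ 2 ∂μ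
            = ∫⁻ x, ‖fderiv ℝ ψ x‖ₑ ^ 2 ∂μ := fun t =>
          lintegral_add_right_eq_self (fun x => ‖fderiv ℝ ψ x‖ₑ ^ 2) (t • z)
        simp [this]

/-- Compare `ψ x` with the mean of `ψ` over the ball. Points `y` of the ball are `x + z` with `‖z‖ <
2 * h`, so the error is controlled by translates over a region independent of `c`. -/
theorem measure_mul_enorm_sq_le {ψ : E → ℝ} (hψ : Continuous ψ) {c x : E} {h : ℝ}
    (hx : x ∈ Metric.ball c h) :
    (μ (Metric.ball 0 h) * ‖ψ x‖ₑ) ^ 2 ≤ 4 * ‖∫ y in Metric.ball c h, ψ y ∂μ‖ₑ ^ 2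
      + 4 * (μ (Metric.ball 0 h) *
        ∫⁻ z in Metric.ball 0 (2 * h), ‖ψ (x + z) - ψ x‖ₑ ^ 2 ∂μ) := by
  have hm : μ (Metric.ball c h) = μ (Metric.ball 0 h) := Measure.addHaar_ball_center μ c h
  have hfin : μ (Metric.ball c h) < ∞ := Metric.isBounded_ball.measure_lt_top
  have hint : IntegrableOn ψ (Metric.ball c h) μ :=
    (hψ.continuousOn.integrableOn_compact (isCompact_closedBall c h)).mono_set
      Metric.ball_subset_closedBall
  have hconst : IntegrableOn (fun _ => ψ x) (Metric.ball c h) μ :=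
    integrableOn_const hfin.ne
  have h1 : μ (Metric.ball 0 h) * ‖ψ x‖ₑ
      ≤ ‖∫ y in Metric.ball c h, ψ y ∂μ‖ₑ + ∫⁻ y in Metric.ball c h, ‖ψ y - ψ x‖ₑ ∂μ := by
    have e1 : ∫ _ in Metric.ball c h, ψ x ∂μ
        = (∫ y in Metric.ball c h, ψ y ∂μ) - ∫ y in Metric.ball c h, (ψ y - ψ x) ∂μ := by
      rw [integral_sub hint hconst]; ring
    have e2 : ‖∫ _ in Metric.ball c h, ψ x ∂μ‖ₑ = μ (Metric.ball 0 h) * ‖ψ x‖ₑ := by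
      rw [setIntegral_const, enorm_smul, ← hm, Measure.real, Real.enorm_eq_ofReal (by positivity),
        ENNReal.ofReal_toReal hfin.ne]
    rw [← e2, e1]
    refine (enorm_sub_le).trans ?_
    gcongr
    exact enorm_integral_le_lintegral_enorm _
  have h2 : ∫⁻ y in Metric.ball c h, ‖ψ y - ψ x‖ₑ ^ 2 ∂μ
      ≤ ∫⁻ z in Metric.ball 0 (2 * h), ‖ψ (x + z) - ψ x‖ₑ ^ 2 ∂μ := by
    rw [← lintegral_indicator measurableSet_ball, ← lintegral_indicator measurableSet_ball,
      ← lintegral_add_left_eq_self _ x]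
    refine lintegral_mono fun z => ?_
    by_cases hz : x + z ∈ Metric.ball c h
    · rw [Set.indicator_of_mem hz, Set.indicator_of_mem]
      have h1 := dist_triangle_right (x + z) x c
      rw [dist_self_add_left] at h1
      rw [mem_ball_zero_iff]
      linarith [Metric.mem_ball.1 hz, Metric.mem_ball.1 hx]
    · rw [Set.indicator_of_notMem hz]
      exact zero_le
  calc (μ (Metric.ball 0 h) * ‖ψ x‖ₑ) ^ 2
      ≤ (‖∫ y in Metric.ball c h, ψ y ∂μ‖ₑ + ∫⁻ y in Metric.ball c h, ‖ψ y - ψ x‖ₑ ∂μ) ^ 2 := by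
        gcongr
    _ ≤ _ := add_sq_le_four_mul _ _
    _ ≤ _ := by
        gcongr
        refine (lintegral_sq_le _ (by fun_prop)).trans ?_
        rw [Measure.restrict_apply_univ, hm]
        gcongr

/-- A quantitative form of the Rellich compactness theorem. -/
theorem lintegral_enorm_sq_le_of_cover {ψ : E → ℝ} (hψ : ContDiff ℝ 1 ψ) {S : Set E}
    (t : Finset E) {h : ℝ} (hS : S ⊆ ⋃ c ∈ t, Metric.ball c h) :
    μ (Metric.ball 0 h) ^ 2 * ∫⁻ x in S, ‖ψ x‖ₑ ^ 2 ∂μ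
      ≤ 4 * (∑ c ∈ t, ‖∫ y in Metric.ball c h, ψ y ∂μ‖ₑ ^ 2) * μ S
        + 4 * (μ (Metric.ball 0 h) * (μ (Metric.ball 0 (2 * h)) *
          (ENNReal.ofReal (2 * h) ^ 2 * ∫⁻ x, ‖fderiv ℝ ψ x‖ₑ ^ 2 ∂μ))) := by
  have hm : μ (Metric.ball 0 h) ≠ ∞ := Metric.isBounded_ball.measure_lt_top.ne
  have hcont : Continuous fun p : E × E => ‖ψ (p.1 + p.2) - ψ p.1‖ₑ ^ 2 := by
    have := hψ.continuous
    fun_prop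
  set g : E → ℝ≥0∞ := fun x => ∫⁻ z in Metric.ball 0 (2 * h), ‖ψ (x + z) - ψ x‖ₑ ^ 2 ∂μ with hg
  have hgm : Measurable g := by
    exact Measurable.lintegral_prod_right' (ν := μ.restrict (Metric.ball 0 (2 * h)))
      hcont.measurable
  have hg2 : ∫⁻ x, g x ∂μ ≤ μ (Metric.ball 0 (2 * h)) *
      (ENNReal.ofReal (2 * h) ^ 2 * ∫⁻ x, ‖fderiv ℝ ψ x‖ₑ ^ 2 ∂μ) := by
    rw [hg, lintegral_lintegral_swap hcont.measurable.aemeasurable]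
    calc ∫⁻ z in Metric.ball 0 (2 * h), (∫⁻ x, ‖ψ (x + z) - ψ x‖ₑ ^ 2 ∂μ) ∂μ
        ≤ ∫⁻ _ in Metric.ball (0 : E) (2 * h),
          (ENNReal.ofReal (2 * h) ^ 2 * ∫⁻ x, ‖fderiv ℝ ψ x‖ₑ ^ 2 ∂μ) ∂μ := by
          refine setLIntegral_mono' measurableSet_ball fun z hz => ?_
          refine (lintegral_enorm_translate_sub_sq_le μ hψ z).trans ?_
          gcongr
          rw [← ofReal_norm]
          exact ENNReal.ofReal_le_ofReal (mem_ball_zero_iff.1 hz).le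
      _ = _ := by rw [setLIntegral_const, mul_comm]
  calc μ (Metric.ball 0 h) ^ 2 * ∫⁻ x in S, ‖ψ x‖ₑ ^ 2 ∂μ
      = ∫⁻ x in S, (μ (Metric.ball 0 h) * ‖ψ x‖ₑ) ^ 2 ∂μ := by
        simp_rw [mul_pow]
        rw [lintegral_const_mul' _ _ (ENNReal.pow_ne_top hm)]
    _ ≤ ∫⁻ x in S, (4 * (∑ c ∈ t, ‖∫ y in Metric.ball c h, ψ y ∂μ‖ₑ ^ 2)
          + 4 * (μ (Metric.ball 0 h) * g x)) ∂μ := by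
        refine setLIntegral_mono (by fun_prop) fun x hx => ?_
        obtain ⟨c, hc, hxc⟩ := Set.mem_iUnion₂.1 (hS hx)
        refine (measure_mul_enorm_sq_le μ hψ.continuous hxc).trans ?_
        gcongr
        -- The ball containing `x` depends on `x`; bounding its term by the sum over all of `t`
        -- gives a constant.
        exact Finset.single_le_sum
          (f := fun c => ‖∫ y in Metric.ball c h, ψ y ∂μ‖ₑ ^ 2) (fun _ _ => zero_le) hc
    _ = 4 * (∑ c ∈ t, ‖∫ y in Metric.ball c h, ψ y ∂μ‖ₑ ^ 2) * μ S
          + 4 * (μ (Metric.ball 0 h) * ∫⁻ x in S, g x ∂μ) := by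
        rw [lintegral_add_left measurable_const, setLIntegral_const,
          lintegral_const_mul' _ _ (by simp), lintegral_const_mul' _ _ hm]
    _ ≤ _ := by
        gcongr
        exact (lintegral_mono' Measure.restrict_le_self le_rfl).trans hg2

end Translation

/-! ### Rellich compactness on `H¹₀`. -/

section Rellich

open scoped ENNReal

theorem enorm_sq_eq_lintegral {α G : Type*} [MeasurableSpace α] {μ : Measure α}
    [NormedAddCommGroup G] (f : Lp G 2 μ) : ‖f‖ₑ ^ 2 = ∫⁻ x, ‖f x‖ₑ ^ 2 ∂μ := by
  have h := eLpNorm_nnreal_pow_eq_lintegral (f := f) (μ := μ) (p := 2) (by norm_num)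
  rw [Lp.enorm_def]
  simpa using h

theorem norm_gradient (f : Rd d → ℝ) (x : Rd d) : ‖gradient f x‖ = ‖fderiv ℝ f x‖ := by
  simp [gradient]

theorem setIntegral_restrict_testFunction (Ω : Opens (Rd d)) (ψ : 𝓓(Ω, ℝ)) {s : Set (Rd d)}
    (hs : MeasurableSet s) :
    ∫ x in s, ψ x ∂(volume.restrict (Ω : Set (Rd d))) = ∫ x in s, ψ x := by
  rw [Measure.restrict_restrict hs]
  refine (setIntegral_eq_of_subset_of_forall_sdiff_eq_zero hs Set.inter_subset_left
    fun x hx => ?_).symm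
  exact image_eq_zero_of_notMem_tsupport fun h => hx.2 ⟨hx.1, ψ.tsupport_subset h⟩

theorem lintegral_fderiv_testFunction_le (Ω : Opens (Rd d)) (ψ : 𝓓(Ω, ℝ)) :
    ∫⁻ x, ‖fderiv ℝ (ψ : Rd d → ℝ) x‖ₑ ^ 2
      ≤ ∫⁻ x in (Ω : Set (Rd d)), ‖fderiv ℝ (ψ : Rd d → ℝ) x‖ₑ ^ 2 := by
  rw [← lintegral_indicator Ω.isOpen.measurableSet]
  refine lintegral_mono fun x => ?_
  by_cases hx : x ∈ (Ω : Set (Rd d))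
  · rw [Set.indicator_of_mem hx]
  · have : fderiv ℝ (ψ : Rd d → ℝ) x = 0 := by
      by_contra hne
      exact hx (ψ.tsupport_subset (support_fderiv_subset ℝ hne))
    rw [this, ← ofReal_norm, norm_zero]
    simp

/-- The cover inequality divided by `|B_h|²`. The gradient constant is `4 · |B_{2h}| / |B_h| · (2h)²
= 16 · 2^d · h²`. -/
theorem testPairs_norm_fst_sq_le {Ω : Opens (Rd d)}
    (hΩ : Bornology.IsBounded (Ω : Set (Rd d))) {h : ℝ} (hh : 0 < h) {t : Finset (Rd d)}
    (ht : (Ω : Set (Rd d)) ⊆ ⋃ c ∈ t, Metric.ball c h) {p : L2Pair Ω} (hp : p ∈ testPairs Ω) :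
    ‖p.fst‖ ^ 2 ≤ 4 * volume.real (Ω : Set (Rd d)) / volume.real (Metric.ball (0 : Rd d) h) ^ 2 *
        (∑ c ∈ t, (∫ x in Metric.ball c h, p.fst x ∂(volume.restrict (Ω : Set (Rd d)))) ^ 2)
      + 16 * 2 ^ d * h ^ 2 * ‖p.snd‖ ^ 2 := by
  obtain ⟨ψ, h1, h2⟩ := hp
  have key := lintegral_enorm_sq_le_of_cover volume (ψ.contDiff.of_le (by simp)) t ht
  have e1 : ∫⁻ x in (Ω : Set (Rd d)), ‖ψ x‖ₑ ^ 2 = ‖p.fst‖ₑ ^ 2 := by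
    rw [enorm_sq_eq_lintegral]
    refine lintegral_congr_ae ?_
    filter_upwards [h1] with x hx
    rw [hx]
  have e2 : ∫⁻ x in (Ω : Set (Rd d)), ‖fderiv ℝ (ψ : Rd d → ℝ) x‖ₑ ^ 2 = ‖p.snd‖ₑ ^ 2 := by
    rw [enorm_sq_eq_lintegral]
    refine lintegral_congr_ae ?_
    filter_upwards [h2] with x hx
    rw [hx, ← ofReal_norm, ← ofReal_norm, norm_gradient]
  have e3 : ∀ c, ∫ x in Metric.ball c h, ψ x
      = ∫ x in Metric.ball c h, p.fst x ∂(volume.restrict (Ω : Set (Rd d))) := fun c => by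
    rw [← setIntegral_restrict_testFunction Ω ψ measurableSet_ball]
    refine integral_congr_ae (ae_restrict_of_ae ?_)
    filter_upwards [h1] with x hx
    rw [hx]
  have key2 := key
  grw [lintegral_fderiv_testFunction_le Ω ψ] at key2
  rw [e1, e2] at key2
  simp_rw [e3] at key2
  have hm : 0 < volume.real (Metric.ball (0 : Rd d) h) :=
    ENNReal.toReal_pos (Metric.measure_ball_pos volume 0 hh).ne'
      Metric.isBounded_ball.measure_lt_top.ne
  have hm2 : volume.real (Metric.ball (0 : Rd d) (2 * h))
      = 2 ^ d * volume.real (Metric.ball (0 : Rd d) h) := by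
    rw [Measure.real, Measure.addHaar_ball_mul_of_pos volume 0 two_pos h, ENNReal.toReal_mul,
      ENNReal.toReal_ofReal (by positivity)]
    simp [Measure.real]
  have f1 : volume (Ω : Set (Rd d)) ≠ ∞ := hΩ.measure_lt_top.ne
  have f2 : ∀ r, volume (Metric.ball (0 : Rd d) r) ≠ ∞ := fun r =>
    Metric.isBounded_ball.measure_lt_top.ne
  have f3 : ∑ c ∈ t, ‖∫ x in Metric.ball c h, p.fst x ∂(volume.restrict (Ω : Set (Rd d)))‖ₑ ^ 2
      ≠ ∞ := ENNReal.sum_ne_top.2 fun _ _ => by simp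
  have f4 : 4 * (∑ c ∈ t, ‖∫ x in Metric.ball c h, p.fst x
      ∂(volume.restrict (Ω : Set (Rd d)))‖ₑ ^ 2) * volume (Ω : Set (Rd d)) ≠ ∞ :=
    ENNReal.mul_ne_top (ENNReal.mul_ne_top (by simp) f3) f1
  have f5 : 4 * (volume (Metric.ball (0 : Rd d) h) * (volume (Metric.ball (0 : Rd d) (2 * h)) *
      (ENNReal.ofReal (2 * h) ^ 2 * ‖p.snd‖ₑ ^ 2))) ≠ ∞ :=
    ENNReal.mul_ne_top (by simp) (ENNReal.mul_ne_top (f2 _) (ENNReal.mul_ne_top (f2 _)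
      (ENNReal.mul_ne_top (ENNReal.pow_ne_top ENNReal.ofReal_ne_top) (by simp))))
  have key3 := ENNReal.toReal_mono (ENNReal.add_ne_top.2 ⟨f4, f5⟩) key2
  rw [ENNReal.toReal_add f4 f5] at key3
  simp only [ENNReal.toReal_mul, ENNReal.toReal_pow, toReal_enorm, Real.norm_eq_abs, sq_abs,
    ENNReal.toReal_sum (fun c (_ : c ∈ t) => ENNReal.pow_ne_top (n := 2) (enorm_ne_top (x :=
      ∫ x in Metric.ball c h, p.fst x ∂(volume.restrict (Ω : Set (Rd d)))))),
    ENNReal.toReal_ofReal (by positivity : 0 ≤ 2 * h)] at key3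
  simp only [← Measure.real_def, hm2] at key3
  have h4 : (4 : ℝ≥0∞).toReal = 4 := by simp
  rw [h4] at key3
  refine le_of_mul_le_mul_left (key3.trans (le_of_eq ?_)) (by positivity :
    0 < volume.real (Metric.ball (0 : Rd d) h) ^ 2)
  field_simp
  ring

theorem H10_norm_fst_sq_le {Ω : Opens (Rd d)}
    (hΩ : Bornology.IsBounded (Ω : Set (Rd d))) {h : ℝ} (hh : 0 < h) {t : Finset (Rd d)}
    (ht : (Ω : Set (Rd d)) ⊆ ⋃ c ∈ t, Metric.ball c h) {p : L2Pair Ω} (hp : p ∈ H10 Ω) :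
    ‖p.fst‖ ^ 2 ≤ 4 * volume.real (Ω : Set (Rd d)) / volume.real (Metric.ball (0 : Rd d) h) ^ 2 *
        (∑ c ∈ t, (∫ x in Metric.ball c h, p.fst x ∂(volume.restrict (Ω : Set (Rd d)))) ^ 2)
      + 16 * 2 ^ d * h ^ 2 * ‖p.snd‖ ^ 2 := by
  have hc1 : Continuous fun p : L2Pair Ω => p.fst := WithLp.continuous_fst _ _ _
  have hc2 : Continuous fun p : L2Pair Ω => p.snd := WithLp.continuous_snd _ _ _
  have hc3 : ∀ c, Continuous fun p : L2Pair Ω =>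
      ∫ x in Metric.ball c h, p.fst x ∂(volume.restrict (Ω : Set (Rd d))) := fun c => by
    have hfin : volume.restrict (Ω : Set (Rd d)) (Metric.ball c h) ≠ ∞ :=
      ((Measure.restrict_apply_le _ _).trans_lt Metric.isBounded_ball.measure_lt_top).ne
    simp_rw [← L2.inner_indicatorConstLp_one (𝕜 := ℝ) measurableSet_ball hfin]
    exact continuous_const.inner hc1
  refine closure_minimal (fun p hp => testPairs_norm_fst_sq_le hΩ hh ht hp)
    (isClosed_le (hc1.norm.pow 2) ?_) hp
  exact (continuous_const.mul (continuous_finsetSum _ fun c _ => (hc3 c).pow 2)).add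
    (continuous_const.mul (hc2.norm.pow 2))

theorem norm_sq_eq_fst_add_snd {Ω : Opens (Rd d)} (p : L2Pair Ω) :
    ‖p‖ ^ 2 = ‖p.fst‖ ^ 2 + ‖p.snd‖ ^ 2 :=
  WithLp.prod_norm_sq_eq_of_L2 p

/-- The embedding of a subspace of `L²(Ω) × L²(Ω; ℝ^d)` into `L²(Ω)`. -/
def fstL (Ω : Opens (Rd d)) (W : Submodule ℝ (L2Pair Ω)) : W →L[ℝ] L2 Ω :=
  (WithLp.fstL 2 ℝ (L2 Ω) (L2Vec Ω)).comp W.subtypeL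

theorem fstL_apply (Ω : Opens (Rd d)) (W : Submodule ℝ (L2Pair Ω)) (p : W) :
    fstL Ω W p = (p : L2Pair Ω).fst := rfl

/-- The Rellich compactness theorem for closed subspaces of `H¹₀(Ω)`. -/
theorem isCompactOperator_fstL {Ω : Opens (Rd d)} (hΩ : Bornology.IsBounded (Ω : Set (Rd d)))
    {W : Submodule ℝ (L2Pair Ω)} (hW : W ≤ H10 Ω) (hWc : IsClosed (W : Set (L2Pair Ω))) :
    IsCompactOperator (fstL Ω W) := by
  have : CompleteSpace W := hWc.completeSpace_coe
  refine isCompactOperator_of_forall_finite_functionals _ fun ε hε => ?_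
  -- Chosen so that the gradient constant `16 * 2 ^ d * h ^ 2` equals `ε ^ 2`. The functionals below
  -- are the integrals over the balls of a finite cover at this scale.
  set h : ℝ := ε / Real.sqrt (16 * 2 ^ d) with hh
  have hpos : 0 < h := by positivity
  obtain ⟨s, -, hs, hcov⟩ :=
    exists_finite_cover_balls_of_isCompact_closure hΩ.isCompact_closure hpos
  set t := hs.toFinset with ht
  have hcov' : (Ω : Set (Rd d)) ⊆ ⋃ c ∈ t, Metric.ball c h := by
    simpa [ht] using hcov
  have hfin : ∀ c, volume.restrict (Ω : Set (Rd d)) (Metric.ball c h) ≠ ∞ := fun c =>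
    ((Measure.restrict_apply_le _ _).trans_lt Metric.isBounded_ball.measure_lt_top).ne
  refine ⟨t.card, fun j => (innerSL ℝ (indicatorConstLp 2 measurableSet_ball
    (hfin (t.equivFin.symm j : Rd d)) (1 : ℝ))).comp (fstL Ω W), fun p hp => ?_⟩
  have h0 : ∀ c ∈ t, ∫ x in Metric.ball c h, (p : L2Pair Ω).fst x
      ∂(volume.restrict (Ω : Set (Rd d))) = 0 := fun c hc => by
    have := hp (t.equivFin ⟨c, hc⟩)
    simp only [Equiv.symm_apply_apply] at this
    rw [← L2.inner_indicatorConstLp_one (𝕜 := ℝ) measurableSet_ball (hfin c)]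
    exact this
  have h1 := H10_norm_fst_sq_le hΩ hpos hcov' (hW p.2)
  rw [Finset.sum_eq_zero fun c hc => by rw [h0 c hc]; simp, mul_zero, zero_add] at h1
  have h2 : 16 * 2 ^ d * h ^ 2 = ε ^ 2 := by
    rw [hh, div_pow, Real.sq_sqrt (by positivity)]
    field_simp
  rw [h2] at h1
  have h3 : ‖(p : L2Pair Ω).snd‖ ^ 2 ≤ ‖p‖ ^ 2 := by
    have := norm_sq_eq_fst_add_snd (p : L2Pair Ω)
    rw [Submodule.coe_norm, this]
    linarith [sq_nonneg ‖(p : L2Pair Ω).fst‖]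
  rw [fstL_apply]
  refine le_of_sq_le_sq ?_ (by positivity)
  rw [mul_pow]
  exact h1.trans (by gcongr)

end Rellich

/-! ### Poincaré inequality, uniqueness of weak gradients, and the space `V`. -/

section Sobolev

open scoped ENNReal

/-- The Poincaré inequality. -/
theorem exists_poincare (hd : 1 ≤ d) {Ω : Opens (Rd d)}
    (hΩ : Bornology.IsBounded (Ω : Set (Rd d))) :
    ∃ C : ℝ, ∀ p ∈ H10 Ω, ‖p.fst‖ ≤ C * ‖p.snd‖ := by
  obtain ⟨R, hR0, hR⟩ := hΩ.subset_ball_lt 0 0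
  have : Nonempty (Fin d) := ⟨⟨0, hd⟩⟩
  -- Translation by a vector of length `2 * R` moves `Ω` off itself, so `ψ (x + z) = 0` on `Ω` and
  -- the translation estimate bounds `ψ` itself. Such a vector exists because `d ≥ 1`.
  obtain ⟨z, hz⟩ := exists_norm_eq (Rd d) (by positivity : 0 ≤ 2 * R)
  refine ⟨2 * R, fun p hp => ?_⟩
  have hc1 : Continuous fun p : L2Pair Ω => p.fst := WithLp.continuous_fst _ _ _
  have hc2 : Continuous fun p : L2Pair Ω => p.snd := WithLp.continuous_snd _ _ _
  refine closure_minimal (fun p hp => ?_)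
    (isClosed_le hc1.norm (continuous_const.mul hc2.norm)) hp
  obtain ⟨ψ, h1, h2⟩ := hp
  have key : ‖p.fst‖ₑ ^ 2 ≤ ‖z‖ₑ ^ 2 * ‖p.snd‖ₑ ^ 2 := by
    calc ‖p.fst‖ₑ ^ 2 = ∫⁻ x in (Ω : Set (Rd d)), ‖ψ x‖ₑ ^ 2 := by
          rw [enorm_sq_eq_lintegral]
          refine lintegral_congr_ae ?_
          filter_upwards [h1] with x hx
          rw [hx]
      _ = ∫⁻ x in (Ω : Set (Rd d)), ‖ψ (x + z) - ψ x‖ₑ ^ 2 := by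
          refine setLIntegral_congr_fun Ω.isOpen.measurableSet fun x hx => ?_
          have h0 : ψ (x + z) = 0 := by
            refine image_eq_zero_of_notMem_tsupport fun h => ?_
            have a1 := mem_ball_zero_iff.1 (hR (ψ.tsupport_subset h))
            have a2 := mem_ball_zero_iff.1 (hR hx)
            have a3 := norm_sub_le (x + z) x
            rw [add_sub_cancel_left, hz] at a3
            linarith
          simp [h0]
      _ ≤ ∫⁻ x, ‖ψ (x + z) - ψ x‖ₑ ^ 2 :=
          lintegral_mono' Measure.restrict_le_self le_rfl
      _ ≤ ‖z‖ₑ ^ 2 * ∫⁻ x, ‖fderiv ℝ (ψ : Rd d → ℝ) x‖ₑ ^ 2 :=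
          lintegral_enorm_translate_sub_sq_le volume (ψ.contDiff.of_le (by simp)) z
      _ ≤ ‖z‖ₑ ^ 2 * ∫⁻ x in (Ω : Set (Rd d)), ‖fderiv ℝ (ψ : Rd d → ℝ) x‖ₑ ^ 2 := by
          grw [lintegral_fderiv_testFunction_le Ω ψ]
      _ = _ := by
          rw [enorm_sq_eq_lintegral p.snd]
          congr 1
          refine lintegral_congr_ae ?_
          filter_upwards [h2] with x hx
          rw [hx, ← ofReal_norm, ← ofReal_norm, norm_gradient]
  have key2 := ENNReal.toReal_mono (by finiteness) key
  simp only [ENNReal.toReal_mul, ENNReal.toReal_pow, toReal_enorm, hz] at key2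
  rw [← mul_pow] at key2
  exact le_of_sq_le_sq key2 (by positivity)

theorem H10_eq_zero_of_snd_eq_zero (hd : 1 ≤ d) {Ω : Opens (Rd d)}
    (hΩ : Bornology.IsBounded (Ω : Set (Rd d))) {p : L2Pair Ω} (hp : p ∈ H10 Ω)
    (h : p.snd = 0) : p = 0 := by
  obtain ⟨C, hC⟩ := exists_poincare hd hΩ
  have h1 := hC p hp
  rw [h, norm_zero, mul_zero] at h1
  have h2 := norm_sq_eq_fst_add_snd p
  rw [h, le_antisymm h1 (norm_nonneg _)] at h2
  simpa using h2

/-- The weak gradient is unique. -/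
theorem H1_eq_zero_of_fst_eq_zero {Ω : Opens (Rd d)} {p : L2Pair Ω} (hp : p ∈ H1 Ω)
    (h : p.fst = 0) : p = 0 := by
  have h0 : ∀ᵐ x ∂volume.restrict (Ω : Set (Rd d)), p.fst x = 0 := by
    rw [h]; exact Lp.coeFn_zero ℝ 2 _
  have hi : ∀ i, ∀ᵐ x ∂volume.restrict (Ω : Set (Rd d)), p.snd x i = 0 := fun i => by
    rw [ae_restrict_iff' Ω.isOpen.measurableSet]
    -- The fundamental lemma of the calculus of variations, applied to each component of the
    -- gradient.
    refine Ω.isOpen.ae_eq_zero_of_integral_contDiff_smul_eq_zero ?_ fun g hg hgc hgs => ?_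
    · rw [locallyIntegrableOn_iff Ω.isOpen.isLocallyClosed]
      intro k hk hkc
      have h1 := (memLp_coord Ω p.snd i).restrict k
      rw [Measure.restrict_restrict hkc.measurableSet, Set.inter_eq_left.2 hk] at h1
      have : IsFiniteMeasure (volume.restrict k) := ⟨by simpa using hkc.measure_lt_top⟩
      exact h1.integrable (by norm_num)
    · have h1 := hp ⟨g, hg, hgc, hgs⟩ i
      rw [integral_eq_zero_of_ae (by filter_upwards [h0] with x hx; simp [hx]), eq_comm,
        neg_eq_zero] at h1
      rw [← setIntegral_eq_integral_of_forall_compl_eq_zero (s := (Ω : Set (Rd d)))]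
      · rw [← h1]
        refine integral_congr_ae (Eventually.of_forall fun x => ?_)
        exact mul_comm _ _
      · intro x hx
        rw [image_eq_zero_of_notMem_tsupport fun h => hx (hgs h), zero_smul]
  have hsnd : p.snd = 0 := by
    rw [Lp.eq_zero_iff_ae_eq_zero]
    filter_upwards [ae_all_iff.2 hi] with x hx
    ext i
    exact hx i
  have h2 := norm_sq_eq_fst_add_snd p
  rw [h, hsnd] at h2
  simpa using h2

theorem fstL_injective {Ω : Opens (Rd d)} {W : Submodule ℝ (L2Pair Ω)} (hW : W ≤ H1 Ω) :
    Function.Injective (fstL Ω W) := by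
  rw [injective_iff_map_eq_zero]
  exact fun p hp => Subtype.ext (H1_eq_zero_of_fst_eq_zero (hW p.2) hp)

theorem V_le_H10 (Ω : Opens (Rd d)) (φ : Rd d → ℝ) : V Ω φ ≤ H10 Ω := fun _ hp => hp.1

/-- The vanishing condition survives limits because an `L²`-convergent sequence has an a.e.
convergent subsequence. -/
theorem isClosed_V (Ω : Opens (Rd d)) (φ : Rd d → ℝ) : IsClosed (V Ω φ : Set (L2Pair Ω)) := by
  refine IsSeqClosed.isClosed fun p q hp hq => ⟨?_, ?_⟩
  · exact (Submodule.isClosed_topologicalClosure _).mem_of_tendsto hq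
      (Eventually.of_forall fun n => (hp n).1)
  · have hfst : Tendsto (fun n => (p n).fst) atTop (𝓝 q.fst) :=
      ((WithLp.continuous_fst _ _ _).tendsto q).comp hq
    obtain ⟨σ, -, hσ⟩ := (tendstoInMeasure_of_tendsto_Lp hfst).exists_seq_tendsto_ae
    filter_upwards [hσ, ae_all_iff.2 fun n => (hp n).2] with x hx h0 hφ
    exact tendsto_nhds_unique hx (by simp [h0 _ hφ])

theorem memLp_gradient (Ω : Opens (Rd d)) (ψ : 𝓓(Ω, ℝ)) :
    MemLp (gradient (ψ : Rd d → ℝ)) 2 (volume.restrict (Ω : Set (Rd d))) := by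
  have h1 : Continuous (fderiv ℝ (ψ : Rd d → ℝ)) := ψ.contDiff.continuous_fderiv (by simp)
  have h2 : HasCompactSupport (fderiv ℝ (ψ : Rd d → ℝ)) := ψ.hasCompactSupport.fderiv (𝕜 := ℝ)
  have h3 : Continuous (gradient (ψ : Rd d → ℝ)) :=
    (InnerProductSpace.toDual ℝ (Rd d)).symm.continuous.comp h1
  have h4 : HasCompactSupport (gradient (ψ : Rd d → ℝ)) :=
    h2.comp_left (g := (InnerProductSpace.toDual ℝ (Rd d)).symm) (map_zero _)
  exact (h3.memLp_of_hasCompactSupport h4).restrict _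

/-- The pair `(ψ, ∇ψ)`. -/
def testPair (Ω : Opens (Rd d)) (ψ : 𝓓(Ω, ℝ)) : L2Pair Ω :=
  WithLp.toLp 2 ((memLp_testFunction Ω ψ).toLp _, (memLp_gradient Ω ψ).toLp _)

theorem testPair_fst_ae (Ω : Opens (Rd d)) (ψ : 𝓓(Ω, ℝ)) :
    ∀ᵐ x ∂volume.restrict (Ω : Set (Rd d)), (testPair Ω ψ).fst x = ψ x :=
  (memLp_testFunction Ω ψ).coeFn_toLp

theorem testPair_mem_testPairs (Ω : Opens (Rd d)) (ψ : 𝓓(Ω, ℝ)) : testPair Ω ψ ∈ testPairs Ω :=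
  ⟨ψ, testPair_fst_ae Ω ψ, (memLp_gradient Ω ψ).coeFn_toLp⟩

theorem testPair_mem_V {Ω : Opens (Rd d)} {φ : Rd d → ℝ} {s : Set (Rd d)}
    (hs : MeasurableSet s) (hφ : ∀ᵐ x ∂volume.restrict s, φ x = 1) {ψ : 𝓓(Ω, ℝ)}
    (hψ : Function.support (ψ : Rd d → ℝ) ⊆ s) : testPair Ω ψ ∈ V Ω φ := by
  refine ⟨(testPairs Ω).le_topologicalClosure (testPair_mem_testPairs Ω ψ), ?_⟩
  rw [ae_restrict_iff' hs] at hφ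
  filter_upwards [testPair_fst_ae Ω ψ, ae_restrict_of_ae hφ] with x hx h1 h2
  rw [hx]
  by_contra hne
  exact h2 (h1 (hψ hne))

theorem testPair_fst_ne_zero {Ω : Opens (Rd d)} {ψ : 𝓓(Ω, ℝ)} {x : Rd d} (hx : ψ x ≠ 0) :
    (testPair Ω ψ).fst ≠ 0 := by
  intro h
  have h0 : ∀ᵐ x ∂volume.restrict (Ω : Set (Rd d)), ψ x = 0 := by
    filter_upwards [testPair_fst_ae Ω ψ, Lp.coeFn_zero ℝ 2 (volume.restrict (Ω : Set (Rd d)))]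
      with x h1 h2
    rw [← h1, h, h2, Pi.zero_apply]
  rw [ae_restrict_iff' Ω.isOpen.measurableSet] at h0
  have h1 : (ψ : Rd d → ℝ) =ᵐ[volume] fun _ => 0 := by
    filter_upwards [h0] with x h2
    by_cases hx : x ∈ (Ω : Set (Rd d))
    · exact h2 hx
    · exact image_eq_zero_of_notMem_tsupport fun h => hx (ψ.tsupport_subset h)
  exact hx (congrFun ((ψ.continuous.ae_eq_iff_eq volume continuous_const).1 h1) x)

/-- There are infinitely many disjoint bumps in a ball. -/
theorem not_finiteDimensional_V (hd : 1 ≤ d) {Ω : Opens (Rd d)} {φ : Rd d → ℝ} {c : Rd d} {r : ℝ}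
    (hr : 0 < r) (hball : Metric.ball c r ⊆ (Ω : Set (Rd d)))
    (hφ : ∀ᵐ x ∂volume.restrict (Metric.ball c r), φ x = 1) :
    ¬ FiniteDimensional ℝ (V Ω φ) := by
  intro hfin
  have : Nonempty (Fin d) := ⟨⟨0, hd⟩⟩
  have : (𝓝[≠] c).NeBot := Module.punctured_nhds_neBot ℝ (Rd d) c
  have : Infinite (Metric.ball c r) :=
    (infinite_of_mem_nhds c (Metric.ball_mem_nhds c hr)).to_subtype
  obtain ⟨U, hUinf, hUo, hUd⟩ := exists_seq_infinite_isOpen_pairwise_disjoint (Metric.ball c r)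
  have hψ : ∀ n, ∃ ψ : 𝓓(Ω, ℝ), Function.support (ψ : Rd d → ℝ) ⊆ Subtype.val '' U n ∧
      ∃ x, ψ x ≠ 0 := by
    intro n
    obtain ⟨x, hx⟩ := (hUinf n).nonempty
    have hopen : IsOpen (Subtype.val '' U n) := Metric.isOpen_ball.isOpenMap_subtype_val _ (hUo n)
    obtain ⟨f, h1, h2, h3, -, h4⟩ :=
      exists_contDiff_tsupport_subset (n := ⊤) (hopen.mem_nhds ⟨x, hx, rfl⟩)
    refine ⟨⟨f, h3, h2, h1.trans ?_⟩, (subset_tsupport f).trans h1, x, ?_⟩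
    · rintro _ ⟨y, -, rfl⟩
      exact hball y.2
    · change f x ≠ 0
      rw [h4]
      exact one_ne_zero
  choose ψ hψs x hx using hψ
  have hVmem : ∀ n, testPair Ω (ψ n) ∈ V Ω φ := fun n =>
    testPair_mem_V measurableSet_ball hφ ((hψs n).trans (by rintro _ ⟨y, -, rfl⟩; exact y.2))
  have hli : LinearIndependent ℝ fun n => (testPair Ω (ψ n)).fst := by
    -- Bumps with disjoint supports are orthogonal in `L²`.
    refine linearIndependent_of_ne_zero_of_inner_eq_zero (𝕜 := ℝ)
      (fun n => testPair_fst_ne_zero (hx n)) fun m n hmn => ?_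
    change inner ℝ (testPair Ω (ψ m)).fst (testPair Ω (ψ n)).fst = 0
    rw [← integral_fst_mul]
    refine integral_eq_zero_of_ae ?_
    filter_upwards [testPair_fst_ae Ω (ψ m), testPair_fst_ae Ω (ψ n)] with y hm hn
    rw [hm, hn, Pi.zero_apply]
    by_contra hne
    obtain ⟨a, ha, hay⟩ := hψs m (left_ne_zero_of_mul hne)
    obtain ⟨b, hb, hby⟩ := hψs n (right_ne_zero_of_mul hne)
    have hab : a = b := Subtype.ext (hay.trans hby.symm)
    exact Set.disjoint_left.1 (hUd hmn) ha (hab ▸ hb)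
  have hli2 : LinearIndependent ℝ fun n => (⟨testPair Ω (ψ n), hVmem n⟩ : V Ω φ) :=
    LinearIndependent.of_comp (fstL Ω (V Ω φ) : V Ω φ →ₗ[ℝ] L2 Ω) hli
  exact Module.Finite.not_linearIndependent_of_infinite _ hli2

end Sobolev

/-! ### Translation between the Dirichlet form and the `H¹` inner product. -/

section Transfer

variable {Ω : Opens (Rd d)} {φ : Rd d → ℝ}

theorem inner_V (u v : V Ω φ) :
    inner ℝ u v = inner ℝ (u : L2Pair Ω).fst (v : L2Pair Ω).fst
      + inner ℝ (u : L2Pair Ω).snd (v : L2Pair Ω).snd :=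
  WithLp.prod_inner_apply _ _

theorem mem_eigenspace_iff (w : V Ω φ) (μ : ℝ) :
    (w : L2Pair Ω) ∈ eigenspace Ω φ μ ↔
      ∀ y, inner ℝ w y = (μ + 1) * inner ℝ (fstL Ω (V Ω φ) w) (fstL Ω (V Ω φ) y) := by
  have h : ∀ y : V Ω φ, (∫ x in (Ω : Set (Rd d)),
      inner ℝ ((w : L2Pair Ω).snd x) ((y : L2Pair Ω).snd x)
      = μ * ∫ x in (Ω : Set (Rd d)), (w : L2Pair Ω).fst x * (y : L2Pair Ω).fst x) ↔
      inner ℝ w y = (μ + 1) * inner ℝ (fstL Ω (V Ω φ) w) (fstL Ω (V Ω φ) y) := fun y => by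
    rw [integral_inner_snd, integral_fst_mul, inner_V, fstL_apply, fstL_apply]
    constructor <;> intro h <;> linarith
  constructor
  · exact fun hw y => (h y).1 (hw.2 y y.2)
  · exact fun hw => ⟨w.2, fun η hη => (h ⟨η, hη⟩).2 (hw ⟨η, hη⟩)⟩

theorem integral_norm_fst_sq (p : L2Pair Ω) :
    ∫ x in (Ω : Set (Rd d)), ‖p.fst x‖ ^ 2 = ‖p.fst‖ ^ 2 := by
  rw [← real_inner_self_eq_norm_sq, L2.inner_def]
  simp_rw [real_inner_self_eq_norm_sq]

theorem integral_norm_snd_sq (p : L2Pair Ω) :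
    ∫ x in (Ω : Set (Rd d)), ‖p.snd x‖ ^ 2 = ‖p.snd‖ ^ 2 := by
  rw [← real_inner_self_eq_norm_sq, L2.inner_def]
  simp_rw [real_inner_self_eq_norm_sq]

/-- The `H¹` quotient exceeds the Rayleigh quotient by exactly `1`. The denominator is nonzero
because a pair in `H¹` with zero first component is zero. -/
theorem mem_rayleighValues_iff (U : Submodule ℝ (L2 Ω)) (r : ℝ) :
    r ∈ rayleighValues Ω φ U ↔ r + 1 ∈ quotientValues (fstL Ω (V Ω φ)) U := by
  have hV : ∀ v : V Ω φ, v ≠ 0 → (r = ‖(v : L2Pair Ω).snd‖ ^ 2 / ‖(v : L2Pair Ω).fst‖ ^ 2 ↔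
      r + 1 = ‖v‖ ^ 2 / ‖fstL Ω (V Ω φ) v‖ ^ 2) := fun v hv => by
    have h0 : ‖(v : L2Pair Ω).fst‖ ^ 2 ≠ 0 := by
      intro h
      refine hv (Subtype.ext (H1_eq_zero_of_fst_eq_zero
        (H10_le_H1 Ω (V_le_H10 Ω φ v.2)) ?_))
      simpa using h
    rw [Submodule.coe_norm, norm_sq_eq_fst_add_snd, fstL_apply, add_div, div_self h0, add_comm,
      add_right_inj]
  constructor
  · rintro ⟨v, hv, hvU, hv0, hr⟩
    rw [integral_norm_snd_sq, integral_norm_fst_sq] at hr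
    have hne : (⟨v, hv⟩ : V Ω φ) ≠ 0 := fun h => hv0 (congrArg Subtype.val h)
    exact ⟨⟨v, hv⟩, hvU, hne, (hV ⟨v, hv⟩ hne).1 hr⟩
  · rintro ⟨v, hvU, hv0, hr⟩
    refine ⟨v, v.2, hvU, fun h => hv0 (Subtype.ext h), ?_⟩
    rw [integral_norm_snd_sq, integral_norm_fst_sq]
    exact (hV v hv0).2 hr

theorem isLeast_rayleighValues_iff (U : Submodule ℝ (L2 Ω)) (m : ℝ) :
    IsLeast (rayleighValues Ω φ U) m ↔ IsLeast (quotientValues (fstL Ω (V Ω φ)) U) (m + 1) := by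
  simp only [IsLeast, lowerBounds, Set.mem_ofPred_eq, mem_rayleighValues_iff]
  refine and_congr_right fun _ => ⟨fun h a ha => ?_, fun h a ha => ?_⟩
  · have := h (a := a - 1) (by simpa using ha)
    linarith
  · have := h ha
    linarith

end Transfer

end LimitEigenvalue

end

/-- Indices start at `0`: `lam k` is the eigenvalue number `k + 1`, so its max-min formula runs over
`k`-dimensional subspaces. The witnesses are the eigensystem of the embedding, with `lam k = κ k -
1`. -/
theorem mainTheorem6 {d : ℕ} (hd : 1 ≤ d)
    (Ω : Opens (EuclideanSpace ℝ (Fin d)))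
    (hΩ : Bornology.IsBounded (Ω : Set (EuclideanSpace ℝ (Fin d))))
    (S₀ S₁ : Set (EuclideanSpace ℝ (Fin d)))
    (hS₀ : MeasurableSet S₀) (hS₁ : MeasurableSet S₁)
    (hS₀Ω : S₀ ⊆ (Ω : Set (EuclideanSpace ℝ (Fin d))))
    (hS₁Ω : S₁ ⊆ (Ω : Set (EuclideanSpace ℝ (Fin d))))
    (hS : Disjoint S₀ S₁)
    (φ : EuclideanSpace ℝ (Fin d) → ℝ)
    (hφBV : IsBVSign Ω φ) (hφU : φ ∈ constraintSet Ω S₀ S₁)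
    (hball : ∃ (c : EuclideanSpace ℝ (Fin d)) (r : ℝ), 0 < r ∧
      Metric.ball c r ⊆ (Ω : Set (EuclideanSpace ℝ (Fin d))) ∧
      ∀ᵐ x ∂volume.restrict (Metric.ball c r), φ x = 1) :
    ∃ (w : ℕ → L2Pair Ω) (lam : ℕ → ℝ),
      -- `L²`-orthonormal eigenfunctions
      (∀ k, IsEigenpair Ω φ (w k) (lam k)) ∧
      (∀ j k, ∫ x in (Ω : Set (EuclideanSpace ℝ (Fin d))), (w j).fst x * (w k).fst x
        = if j = k then 1 else 0) ∧
      -- ordering and divergence of the eigenvalues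
      0 < lam 0 ∧ Monotone lam ∧ Tendsto lam atTop atTop ∧
      -- no further eigenvalues; each one is repeated according to its multiplicity
      (∀ (v : L2Pair Ω) (μ : ℝ), IsEigenpair Ω φ v μ → ∃ k, lam k = μ) ∧
      (∀ k, FiniteDimensional ℝ (eigenspace Ω φ (lam k)) ∧
        Set.ncard {j | lam j = lam k} = Module.finrank ℝ (eigenspace Ω φ (lam k))) ∧
      -- orthonormal basis and series expansion, convergent in the `H¹` norm
      IsOrthonormalBasisOfV Ω φ (fun k => (1 / Real.sqrt (lam k)) • w k) ∧
      (∀ u ∈ V Ω φ,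
        HasSum (fun k =>
          (∫ x in (Ω : Set (EuclideanSpace ℝ (Fin d))), u.fst x * (w k).fst x) • w k) u) ∧
      -- Courant–Fischer: all minima exist, their maximum over `𝒮_k` is `lam k`, and it is
      -- attained at the span of the first `k` eigenfunctions
      (∀ k,
        (∀ U ∈ subspacesOfDim Ω k, ∃ m, IsLeast (rayleighValues Ω φ U) m) ∧
        IsGreatest {m | ∃ U ∈ subspacesOfDim Ω k, IsLeast (rayleighValues Ω φ U) m} (lam k) ∧
        Submodule.span ℝ ((fun j => (w j).fst) '' Set.Iio k) ∈ subspacesOfDim Ω k ∧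
        IsLeast (rayleighValues Ω φ (Submodule.span ℝ ((fun j => (w j).fst) '' Set.Iio k)))
          (lam k)) := by
  obtain ⟨c, r, hr, hball, hφ⟩ := hball
  have hVc := isClosed_V Ω φ
  have : CompleteSpace (V Ω φ) := hVc.completeSpace_coe
  set T := fstL Ω (V Ω φ)
  have hT : IsCompactOperator T := isCompactOperator_fstL hΩ (V_le_H10 Ω φ) hVc
  have hinj : Function.Injective T :=
    fstL_injective ((V_le_H10 Ω φ).trans (H10_le_H1 Ω))
  have hinf := not_finiteDimensional_V hd hr hball hφ
  obtain ⟨w, κ, E⟩ := exists_isEigensystem T hT hinj hinf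
  have hsnd : ∀ j k, inner ℝ (w j : L2Pair Ω).snd (w k : L2Pair Ω).snd
      = if j = k then κ j - 1 else 0 := fun j k => by
    have h1 := inner_V (w j) (w k)
    have h2 : inner ℝ (w j : L2Pair Ω).fst (w k : L2Pair Ω).fst = if j = k then 1 else 0 :=
      orthonormal_iff_ite.1 E.orthonormal j k
    rw [E.inner_eigenvectors, h2] at h1
    split_ifs at h1 ⊢ <;> linarith
  have hne : ∀ k, w k ≠ 0 := fun k => E.linearIndependent.ne_zero k
  -- `κ k - 1` is the squared norm of the gradient of `w k`, nonzero by the Poincaré inequality.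
  have hpos : ∀ k, 0 < κ k - 1 := fun k => by
    have h1 := hsnd k k
    rw [if_pos rfl, real_inner_self_eq_norm_sq] at h1
    rw [← h1]
    have : (w k : L2Pair Ω).snd ≠ 0 := fun h =>
      hne k (Subtype.ext (H10_eq_zero_of_snd_eq_zero hd hΩ (V_le_H10 Ω φ (w k).2) h))
    have := norm_pos_iff.2 this
    positivity
  have heig : ∀ k, (w k : L2Pair Ω) ∈ eigenspace Ω φ (κ k - 1) := fun k => by
    rw [mem_eigenspace_iff, sub_add_cancel]
    exact E.inner_eq k
  have hsum : ∀ u : V Ω φ, HasSum (fun k =>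
      (∫ x in (Ω : Set (EuclideanSpace ℝ (Fin d))),
        (u : L2Pair Ω).fst x * (w k : L2Pair Ω).fst x) • (w k : L2Pair Ω)) u := fun u => by
    have h1 := (E.hasSum hinj u).mapL (V Ω φ).subtypeL
    refine h1.congr_fun fun k => ?_
    rw [integral_fst_mul]
    rfl
  refine ⟨fun k => w k, fun k => κ k - 1, fun k => ⟨heig k, fun h => hne k (Subtype.ext h)⟩,
    fun j k => ?_, hpos 0, fun j k hjk => sub_le_sub_right (E.mono hjk) 1,
    tendsto_atTop_add_const_right _ (-1) E.tendsto, fun v μ hv => ?_, fun k => ?_,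
    ⟨fun k => (V Ω φ).smul_mem _ (w k).2, fun j k => ?_, fun u hu ε hε => ?_⟩,
    fun u hu => hsum ⟨u, hu⟩, fun k => ⟨fun U hU => ?_, ⟨?_, ?_⟩, ?_, ?_⟩⟩
  · rw [integral_fst_mul]
    exact orthonormal_iff_ite.1 E.orthonormal j k
  · obtain ⟨k, hk⟩ := E.exists_eigenvalue_eq hinj (v := ⟨v, hv.1.1⟩)
      (fun h => hv.2 (congrArg Subtype.val h)) ((mem_eigenspace_iff ⟨v, hv.1.1⟩ μ).1 hv.1)
    exact ⟨k, sub_eq_iff_eq_add.2 hk⟩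
  · have hset : {j | κ j - 1 = κ k - 1} = {j | κ j = κ k} := by simp
    have hspan : eigenspace Ω φ (κ k - 1)
        = Submodule.span ℝ ((fun j => (w j : L2Pair Ω)) '' {j | κ j = κ k}) := by
      refine le_antisymm (fun v hv => ?_) (Submodule.span_le.2 ?_)
      · have h1 := E.mem_span_of_eigenvector hinj ((mem_eigenspace_iff ⟨v, hv.1⟩ _).1 hv)
        rw [sub_add_cancel] at h1
        have h2 := Submodule.mem_map_of_mem (f := (V Ω φ).subtype) h1
        rw [Submodule.map_span, ← Set.image_comp] at h2
        exact h2
      · rintro _ ⟨j, hj, rfl⟩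
        have hj' : κ j = κ k := hj
        rw [← hj']
        exact heig j
    have hfin := E.finite_setOf_eq (κ k)
    have hli : LinearIndependent ℝ fun j => (w j : L2Pair Ω) :=
      E.linearIndependent.map' (V Ω φ).subtype (Submodule.ker_subtype _)
    rw [hset, hspan]
    refine ⟨FiniteDimensional.span_of_finite ℝ (hfin.image _), ?_⟩
    have := hfin.fintype
    have h1 := finrank_span_eq_card
      (hli.comp (fun j : {j | κ j = κ k} => (j : ℕ)) Subtype.val_injective)
    rw [Set.range_comp, Subtype.range_coe] at h1
    rw [h1, ← Nat.card_eq_fintype_card, Nat.card_coe_set_eq]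
  · rw [integral_inner_snd, WithLp.smul_snd, WithLp.smul_snd, real_inner_smul_left,
      real_inner_smul_right, hsnd]
    split_ifs with h
    · subst h
      have h1 := Real.sqrt_pos.2 (hpos j)
      field_simp
      exact (Real.sq_sqrt (hpos j).le).symm
    · simp
  -- A partial sum of the expansion within `√ε` of `u` in `H¹` is also that close in the gradient
  -- norm, which the `H¹` norm dominates.
  · have h1 := (Metric.tendsto_nhds.1 (hsum ⟨u, hu⟩)) (Real.sqrt ε) (Real.sqrt_pos.2 hε)
    obtain ⟨s, hs⟩ := h1.exists
    refine ⟨_, Submodule.sum_mem (t := s) (f := fun k =>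
      (∫ x in (Ω : Set (EuclideanSpace ℝ (Fin d))), u.fst x * (w k : L2Pair Ω).fst x) •
        (w k : L2Pair Ω)) _ fun k _ => Submodule.smul_mem _ _ ?_, ?_⟩
    · have h2 := (Submodule.span ℝ (Set.range fun k =>
        (1 / Real.sqrt (κ k - 1)) • (w k : L2Pair Ω))).smul_mem (Real.sqrt (κ k - 1))
        (Submodule.subset_span ⟨k, rfl⟩)
      have h3 := (Real.sqrt_pos.2 (hpos k)).ne'
      simpa only [smul_smul, mul_one_div_cancel h3, one_smul] using h2
    · rw [integral_norm_snd_sq]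
      rw [dist_comm, dist_eq_norm, Real.lt_sqrt (norm_nonneg _), norm_sq_eq_fst_add_snd] at hs
      refine lt_of_le_of_lt ?_ hs
      exact le_add_of_nonneg_left (sq_nonneg _)
  · have : FiniteDimensional ℝ U := hU.1
    obtain ⟨m, hm⟩ := exists_isLeast_quotientValues hT hinj hinf U
    exact ⟨m - 1, (isLeast_rayleighValues_iff U _).2 (by rwa [sub_add_cancel])⟩
  · exact ⟨_, E.finrank_span_Iio k,
      (isLeast_rayleighValues_iff _ _).2 (by rw [sub_add_cancel]; exact E.isLeast_span hinj k)⟩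
  · rintro m ⟨U, hU, hm⟩
    have : FiniteDimensional ℝ U := hU.1
    have := E.le_of_isLeast hU.2 ((isLeast_rayleighValues_iff U m).1 hm)
    linarith
  · exact E.finrank_span_Iio k
  · exact (isLeast_rayleighValues_iff _ _).2 (by rw [sub_add_cancel]; exact E.isLeast_span hinj k)
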